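/- **Proposition 1.6.** Let $X$ be a finite polyhedron (a space homeomorphic to a finite simplicial complex) with a metric $d$ inducing its topology, let $\Phi: X\times\mathbf R\to X$, $(x,t)\mapsto x\cdot t$, be a continuous flow and let $\xi\in H^1(X;\mathbf Z)$. *Notation.* For $\delta,T>0$, a $(\delta,T)$-chain from $x$ to $y$ consists of points $x=x_0,x_1,\dots,x_N=y$ ($N\ge 1$) and numbers $t_1,\dots,t_N\ge T$ with $d(x_{i-1}\cdot t_i,x_i)<\delta$ for all $i$; it is closed if $x=y$. A $(\delta,T)$-cycle is a pair $(x,t)$ with $t\ge T$ and $d(x,x\cdot t)<\delta$, i.e. a closed $(\delta,T)$-chain with $N=1$. The chain recurrent set $R$ is the set of all $x\in X$ such that for all $\delta>0$, $T\ge1$ there is a $(\delta,T)$-chain from $x$ to $x$. A scale of $\xi$ is a pair $\varepsilon,\delta>0$ such that $\xi|_B=0$ for every ball $B$ of radius $2\varepsilon$ and any two points at distance less than $\delta$ are joined by a path lying in some ball of radius $\varepsilon$. Given a scale $(\varepsilon,\delta)$, a class $z\in H_1(X;\mathbf Z)$ is associated with a closed $(\delta,T)$-chain if it is the class of the singular cycle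 formed by the trajectories from $x_{i-1}$ to $x_{i-1}\cdot t_i$ and by paths from $x_{i-1}\cdot t_i$ to $x_i$, each of which lies in a ball of radius $\varepsilon$; the number $\langle\xi,z\rangle$ depends only on the chain. Let $R_\xi$ be the set of all $x\in X$ such that for all $0<\delta'<\delta$ and $T>1$ there is a $(\delta',T)$-chain from $x$ to $x$ with $\langle\xi,z\rangle=0$ for every class $z$ associated with it (this does not depend on the scale), and put $C_\xi=R\setminus R_\xi$. Let $D_X=H_1(X;\mathbf R)/\mathbf R_+$, where $\mathbf R_+$ is the group of positive reals, topologized as the disjoint union of the unit sphere and the origin. A closing sequence based at $p\in X$ is a sequence $(x_n,t_n)\in X\times(1,\infty)$ with $x_n\to p$ and $x_n\cdot t_n\to p$. Let $z_n\in H_1(X;\mathbf Z)$ be the class of the loop that follows the flow from $x_n$ to $x_n\cdot t_n$ and returns to $x_n$ along a short path, the diameters of these paths tending to $0$ (for large $n$, $z_n$ does not depend on the path), and let $\tilde z_n\in D_X$ be the direction of $z_n$. *Statement.* Assume that $R_\xi$ is isolated in $R$, that is, $R_\xi$ is open in $R$. Then the following two conditions are equivalent. 1. (Condition (B)) There are $\delta>0$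 and $T>1$ such that every class $z\in H_1(X;\mathbf Z)$ associated with a $(\delta,T)$-cycle $(x,t)$ with $x\in C_\xi$ satisfies $\langle\xi,z\rangle\le-1$. 2. (Fried's condition) For every closing sequence $(x_n,t_n)$, based at any point of $X$, with $x_n\in C_\xi$ for all $n$, and every $\tilde z\in D_X$ with $\tilde z=\lim\tilde z_n$, one has $\langle\xi,\tilde z\rangle<0$. -/

import Mathlib

open CategoryTheory AlgebraicTopology Filter Topology TensorProduct

noncomputable section

namespace FlowClosing

/-! ### Finite polyhedra -/

/-- A finite polyhedron: a space homeomorphic to the underlying space of a finite simplicial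
complex in some Euclidean space. -/
def IsFinitePolyhedron (X : Type) [TopologicalSpace X] : Prop :=
  ∃ (m : ℕ) (K : Geometry.SimplicialComplex ℝ (EuclideanSpace ℝ (Fin m))),
    K.faces.Finite ∧ Nonempty (X ≃ₜ K.space)

/-! ### Singular homology and cohomology in degree one -/

/-- The singular chain complex of `X` with integer coefficients. -/
abbrev singularComplex (X : Type) [TopologicalSpace X] : ChainComplex (ModuleCat.{0} ℤ) ℕ :=
  ((singularChainComplexFunctor (ModuleCat.{0} ℤ)).obj (ModuleCat.of ℤ ℤ)).obj (TopCat.of X)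

/-- The singular homology group `H₁(X; ℤ)`. -/
abbrev Homology₁ (X : Type) [TopologicalSpace X] : ModuleCat.{0} ℤ :=
  (singularComplex X).homology 1

/-- The homology group `H₁(X; ℝ) = ℝ ⊗ H₁(X; ℤ)`. -/
abbrev RealHomology₁ (X : Type) [TopologicalSpace X] : Type := ℝ ⊗[ℤ] (Homology₁ X)

/-- The singular `1`-cocycles of `X` with values in `ℤ`. -/
def cocycles₁ (X : Type) [TopologicalSpace X] :
    Submodule ℤ (Module.Dual ℤ ((singularComplex X).X 1)) :=
  LinearMap.ker ((singularComplex X).d 2 1).hom.dualMap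

/-- The singular `1`-coboundaries of `X` with values in `ℤ`. -/
def coboundaries₁ (X : Type) [TopologicalSpace X] :
    Submodule ℤ (Module.Dual ℤ ((singularComplex X).X 1)) :=
  LinearMap.range ((singularComplex X).d 1 0).hom.dualMap

/-- The singular cohomology group `H¹(X; ℤ)`. -/
abbrev Cohomology₁ (X : Type) [TopologicalSpace X] : Type :=
  cocycles₁ X ⧸ (coboundaries₁ X).submoduleOf (cocycles₁ X)

theorem d_comp_cocycle {X : Type} [TopologicalSpace X] (φ : cocycles₁ X) :
    (singularComplex X).d 2 1 ≫ ModuleCat.ofHom φ.1 = 0 := by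
  ext1
  exact φ.2

/-- The homomorphism `H₁(X; ℤ) → ℤ`, `[c] ↦ φ(c)`, given by a cocycle `φ`. -/
def evalCocycle {X : Type} [TopologicalSpace X] (φ : cocycles₁ X) :
    Homology₁ X ⟶ ModuleCat.of ℤ ℤ :=
  (singularComplex X).homologyι 1 ≫
    (singularComplex X).descOpcycles (ModuleCat.ofHom φ.1) 2 (by simp) (d_comp_cocycle φ)

theorem homologyπ_evalCocycle {X : Type} [TopologicalSpace X] (φ : cocycles₁ X) :
    (singularComplex X).homologyπ 1 ≫ evalCocycle φ =
      (singularComplex X).iCycles 1 ≫ ModuleCat.ofHom φ.1 := by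
  rw [evalCocycle, HomologicalComplex.homology_π_ι_assoc]
  exact congrArg _ ((singularComplex X).p_descOpcycles _ 2 _ _)

theorem evalCocycle_apply {X : Type} [TopologicalSpace X] (φ : cocycles₁ X)
    (c : (singularComplex X).cycles 1) :
    (evalCocycle φ).hom (((singularComplex X).homologyπ 1).hom c) =
      φ.1 (((singularComplex X).iCycles 1).hom c) :=
  congrArg (fun f => f.hom c) (homologyπ_evalCocycle φ)

theorem homologyπ_surjective {X : Type} [TopologicalSpace X] :
    Function.Surjective ((singularComplex X).homologyπ 1).hom :=
  (ModuleCat.epi_iff_surjective _).1 inferInstance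

/-- The Kronecker pairing on cocycles. -/
def cocyclePairing (X : Type) [TopologicalSpace X] : cocycles₁ X →ₗ[ℤ] (Homology₁ X →ₗ[ℤ] ℤ) where
  toFun φ := (evalCocycle φ).hom
  map_add' φ ψ := by
    refine LinearMap.ext fun z => ?_
    obtain ⟨c, rfl⟩ := homologyπ_surjective z
    rw [LinearMap.add_apply]
    erw [evalCocycle_apply, evalCocycle_apply, evalCocycle_apply]
    rfl
  map_smul' a φ := by
    refine LinearMap.ext fun z => ?_
    obtain ⟨c, rfl⟩ := homologyπ_surjective z
    rw [LinearMap.smul_apply]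
    erw [evalCocycle_apply, evalCocycle_apply]
    rfl

/-- The Kronecker pairing `⟨ξ, z⟩ ∈ ℤ` of `ξ ∈ H¹(X; ℤ)` with `z ∈ H₁(X; ℤ)`. -/
def pairing {X : Type} [TopologicalSpace X] : Cohomology₁ X →ₗ[ℤ] (Homology₁ X →ₗ[ℤ] ℤ) :=
  Submodule.liftQ _ (cocyclePairing X) (by
    rintro φ ⟨ψ, hψ⟩
    rw [LinearMap.mem_ker]
    ext z
    obtain ⟨c, rfl⟩ := homologyπ_surjective z
    have h := congrArg (fun f => ψ (f.hom c)) ((singularComplex X).iCycles_d 1 0)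
    refine (evalCocycle_apply φ c).trans ?_
    have h' := LinearMap.congr_fun hψ (((singularComplex X).iCycles 1).hom c)
    simp only [Submodule.subtype_apply] at h'
    rw [← h']
    exact h.trans (map_zero ψ))

/-- The pairing `⟨ξ, v⟩ ∈ ℝ` of `ξ ∈ H¹(X; ℤ)` with `v ∈ H₁(X; ℝ)`, the real linear extension
of the Kronecker pairing. -/
def realPairing {X : Type} [TopologicalSpace X] (ξ : Cohomology₁ X) : RealHomology₁ X →ₗ[ℝ] ℝ :=
  (TensorProduct.AlgebraTensorModule.rid ℤ ℝ ℝ).toLinearMap ∘ₗ (pairing ξ).baseChange ℝ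

/-- The chain map induced by a continuous map. -/
abbrev singularMap {Y X : Type} [TopologicalSpace Y] [TopologicalSpace X] (f : C(Y, X)) :
    singularComplex Y ⟶ singularComplex X :=
  ((singularChainComplexFunctor (ModuleCat.{0} ℤ)).obj (ModuleCat.of ℤ ℤ)).map (TopCat.ofHom f)

theorem dualMap_mem_cocycles {Y X : Type} [TopologicalSpace Y] [TopologicalSpace X] (f : C(Y, X))
    (φ : Module.Dual ℤ ((singularComplex X).X 1)) (hφ : φ ∈ cocycles₁ X) :
    ((singularMap f).f 1).hom.dualMap φ ∈ cocycles₁ Y := by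
  refine LinearMap.mem_ker.2 (LinearMap.ext fun c => ?_)
  have h := congrArg (fun g => φ (g.hom c)) ((singularMap f).comm 2 1)
  have h' := LinearMap.congr_fun (LinearMap.mem_ker.1 hφ) (((singularMap f).f 2).hom c)
  exact h.symm.trans h'

theorem dualMap_mem_coboundaries {Y X : Type} [TopologicalSpace Y] [TopologicalSpace X]
    (f : C(Y, X)) (φ : Module.Dual ℤ ((singularComplex X).X 1)) (hφ : φ ∈ coboundaries₁ X) :
    ((singularMap f).f 1).hom.dualMap φ ∈ coboundaries₁ Y := by
  obtain ⟨ψ, rfl⟩ := hφ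
  refine ⟨((singularMap f).f 0).hom.dualMap ψ, LinearMap.ext fun c => ?_⟩
  exact (congrArg (fun g => ψ (g.hom c)) ((singularMap f).comm 1 0)).symm

/-- The homomorphism `f^* : H¹(X; ℤ) → H¹(Y; ℤ)` induced by a continuous map `f : Y → X`. -/
def pullback {Y X : Type} [TopologicalSpace Y] [TopologicalSpace X] (f : C(Y, X)) :
    Cohomology₁ X →ₗ[ℤ] Cohomology₁ Y :=
  Submodule.mapQ _ _
    (((singularMap f).f 1).hom.dualMap.restrict (dualMap_mem_cocycles f))
    (fun φ hφ => dualMap_mem_coboundaries f φ.1 hφ)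

/-- The restriction `ξ|_B` of a cohomology class to a subspace `B ⊆ X`. -/
def restriction {X : Type} [TopologicalSpace X] (ξ : Cohomology₁ X) (B : Set X) : Cohomology₁ B :=
  pullback ⟨((↑) : B → X), continuous_subtype_val⟩ ξ

/-- A path in `X` as a singular `1`-chain (the singular `1`-simplex that runs along the path from
vertex `0` to vertex `1`). -/
def pathChain {X : Type} [TopologicalSpace X] {x y : X} (γ : Path x y) : (singularComplex X).X 1 :=
  ((TopCat.toSSet.obj (TopCat.of X)).ιChainComplex (R := ModuleCat.of ℤ ℤ) (n := 1)
    (((TopCat.of X).toSSetObjEquiv _).symm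
      (γ.toContinuousMap.comp (stdSimplexHomeomorphUnitInterval : C(_, _))))).hom (1 : ℤ)

/-- `z ∈ H₁(X; ℤ)` is the homology class of the singular `1`-chain `c` (in particular `c` is a
cycle). -/
def IsHomologyClass {X : Type} [TopologicalSpace X] (c : (singularComplex X).X 1)
    (z : Homology₁ X) : Prop :=
  ∃ w : (singularComplex X).cycles 1,
    ((singularComplex X).iCycles 1).hom w = c ∧ ((singularComplex X).homologyπ 1).hom w = z

/-! ### Homology directions -/

/-- Two vectors of `H₁(X; ℝ)` are equivalent if they differ by a positive factor. -/
def directionSetoid (X : Type) [TopologicalSpace X] : Setoid (RealHomology₁ X) where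
  r v w := ∃ a : ℝ, 0 < a ∧ w = a • v
  iseqv :=
    { refl := fun v => ⟨1, one_pos, (one_smul ℝ v).symm⟩
      symm := by
        rintro v _ ⟨a, ha, rfl⟩
        exact ⟨a⁻¹, inv_pos.2 ha, by rw [smul_smul, inv_mul_cancel₀ ha.ne', one_smul]⟩
      trans := by
        rintro v _ _ ⟨a, ha, rfl⟩ ⟨b, hb, rfl⟩
        exact ⟨b * a, mul_pos hb ha, by rw [smul_smul]⟩ }

/-- The space `D_X = H₁(X; ℝ) / ℝ₊` of homology directions. -/
def Direction (X : Type) [TopologicalSpace X] : Type := Quotient (directionSetoid X)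

/-- The class in `D_X` of a vector of `H₁(X; ℝ)`. -/
def Direction.mk {X : Type} [TopologicalSpace X] (v : RealHomology₁ X) : Direction X :=
  Quotient.mk (directionSetoid X) v

/-- `D_X` is the disjoint union of the unit sphere `(H₁(X; ℝ) ∖ {0}) / ℝ₊`, with the quotient
topology, and the origin. Here `H₁(X; ℝ)` has its canonical topology as a real vector space (the
norm topology, as it is finite-dimensional for a finite polyhedron). Since `0` is not in the domain
of the map along which the topology is coinduced, its class is an isolated point. -/
instance (X : Type) [TopologicalSpace X] : TopologicalSpace (Direction X) :=
  letI : TopologicalSpace (RealHomology₁ X) := moduleTopology ℝ (RealHomology₁ X)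
  TopologicalSpace.coinduced (fun v : {v : RealHomology₁ X // v ≠ 0} => Direction.mk v.1) inferInstance

/-- The direction of an integral homology class `z ∈ H₁(X; ℤ)`. -/
def Direction.ofInt {X : Type} [TopologicalSpace X] (z : Homology₁ X) : Direction X :=
  Direction.mk ((1 : ℝ) ⊗ₜ[ℤ] z)

/-- `⟨ξ, d⟩ < 0` for a homology direction `d`; the sign does not depend on the vector that
represents `d`. -/
def Direction.PairsNegatively {X : Type} [TopologicalSpace X] (ξ : Cohomology₁ X)
    (d : Direction X) : Prop :=
  Quotient.lift (fun v : RealHomology₁ X => realPairing ξ v < 0) (by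
    rintro v _ ⟨a, ha, rfl⟩
    simp only [map_smul, smul_eq_mul, eq_iff_iff]
    exact ⟨fun h => mul_neg_of_pos_of_neg ha h, fun h => by nlinarith⟩) d

/-! ### Chains of a flow and the chain recurrent sets -/

variable {X : Type} [MetricSpace X]

/-- The trajectory of the flow `Φ` from `x` to `x·t`. -/
def flowPath (Φ : Flow ℝ X) (x : X) (t : ℝ) : Path x (Φ t x) where
  toFun s := Φ (s * t) x
  continuous_toFun := Φ.continuous (by fun_prop) continuous_const
  source' := by simp
  target' := by simp

/-- A `(δ, T)`-chain of the flow `Φ` from `x` to `y`: points `x = x₀, x₁, …, x_N = y`, `N ≥ 1`,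
and times `t₁, …, t_N ≥ T` with `d(x_{i-1}·t_i, x_i) < δ`. -/
structure FlowChain (Φ : Flow ℝ X) (δ T : ℝ) (x y : X) where
  /-- the number of pieces -/
  length : ℕ
  length_pos : 0 < length
  /-- the points `x₀, …, x_N` -/
  pt : Fin (length + 1) → X
  /-- the times `t₁, …, t_N`, where `time i` belongs to the piece that starts at `x_i` -/
  time : Fin length → ℝ
  pt_zero : pt 0 = x
  pt_last : pt (Fin.last length) = y
  le_time : ∀ i, T ≤ time i
  dist_lt : ∀ i, dist (Φ (time i) (pt i.castSucc)) (pt i.succ) < δ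

/-- The chain recurrent set `R = R(Φ)`. -/
def chainRecurrentSet (Φ : Flow ℝ X) : Set X :=
  {x | ∀ δ : ℝ, 0 < δ → ∀ T : ℝ, 1 ≤ T → Nonempty (FlowChain Φ δ T x x)}

/-- `(ε, δ)` is a scale of `ξ`: the class `ξ` vanishes on all balls of radius `2ε`, and any two
points at distance less than `δ` are connected by a path inside some ball of radius `ε`. -/
def IsScale (ξ : Cohomology₁ X) (ε δ : ℝ) : Prop :=
  0 < ε ∧ 0 < δ ∧
    (∀ p : X, restriction ξ (Metric.ball p (2 * ε)) = 0) ∧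
    ∀ x y : X, dist x y < δ → ∃ (σ : Path x y) (p : X), Set.range σ ⊆ Metric.ball p ε

/-- `z` is a homology class associated with the closed chain `c`: the class of the singular cycle
made of the trajectories from `x_{i-1}` to `x_{i-1}·t_i` and of paths `σ_i` from `x_{i-1}·t_i` to
`x_i`, each of them inside a ball of radius `ε`. -/
def FlowChain.IsAssociated {Φ : Flow ℝ X} {δ T : ℝ} {x : X} (c : FlowChain Φ δ T x x) (ε : ℝ)
    (z : Homology₁ X) : Prop :=
  ∃ σ : ∀ i : Fin c.length, Path (Φ (c.time i) (c.pt i.castSucc)) (c.pt i.succ),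
    (∀ i, ∃ p : X, Set.range (σ i) ⊆ Metric.ball p ε) ∧
    IsHomologyClass
      (∑ i, (pathChain (flowPath Φ (c.pt i.castSucc) (c.time i)) + pathChain (σ i))) z

/-- The chain recurrent set `R_ξ` of the flow `Φ` and the class `ξ`. (It does not depend on the
choice of the scale.) -/
def chainRecurrentSetOf (Φ : Flow ℝ X) (ξ : Cohomology₁ X) : Set X :=
  {x | ∃ ε δ : ℝ, IsScale ξ ε δ ∧ ∀ δ' : ℝ, 0 < δ' → δ' < δ → ∀ T : ℝ, 1 < T →
    ∃ c : FlowChain Φ δ' T x x, ∀ z : Homology₁ X, c.IsAssociated ε z → pairing ξ z = 0}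

/-- The set `C_ξ = R ∖ R_ξ`. -/
def circulationSet (Φ : Flow ℝ X) (ξ : Cohomology₁ X) : Set X :=
  chainRecurrentSet Φ \ chainRecurrentSetOf Φ ξ

/-- `R_ξ` is isolated in `R`: it is open in `R`. -/
def IsIsolatedInR (Φ : Flow ℝ X) (ξ : Cohomology₁ X) : Prop :=
  ∃ U : Set X, IsOpen U ∧ U ∩ chainRecurrentSet Φ = chainRecurrentSetOf Φ ξ

/-- `z` is the homology class of the loop that follows the flow from `x` to `x·t` and returns to
`x` along the path `σ`. -/
def IsClosingClass (Φ : Flow ℝ X) (x : X) (t : ℝ) (σ : Path (Φ t x) x) (z : Homology₁ X) : Prop :=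
  IsHomologyClass (pathChain (flowPath Φ x t) + pathChain σ) z

/-- Condition (B): for some `δ > 0` and `T > 1`, every homology class `z` associated with a
`(δ, T)`-cycle `(x, t)` with `x ∈ C_ξ` satisfies `⟨ξ, z⟩ ≤ -1`. (A smaller `δ` again gives a scale,
and whether the condition holds does not depend on `ε`.) -/
def ConditionB (Φ : Flow ℝ X) (ξ : Cohomology₁ X) : Prop :=
  ∃ ε δ T : ℝ, IsScale ξ ε δ ∧ 1 < T ∧
    ∀ x ∈ circulationSet Φ ξ, ∀ t : ℝ, T ≤ t → dist x (Φ t x) < δ →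
      ∀ (σ : Path (Φ t x) x) (p : X), Set.range σ ⊆ Metric.ball p ε →
        ∀ z : Homology₁ X, IsClosingClass Φ x t σ z → pairing ξ z ≤ -1

/-- `(x_n, t_n)` is a closing sequence based at `p`. -/
def IsClosingSequence (Φ : Flow ℝ X) (p : X) (x : ℕ → X) (t : ℕ → ℝ) : Prop :=
  (∀ n, 1 < t n) ∧ Tendsto x atTop (𝓝 p) ∧ Tendsto (fun n => Φ (t n) (x n)) atTop (𝓝 p)

/-- `d` is the limit of the homology directions of the closing sequence `(x_n, t_n)`: the limit in
`D_X` of the directions of the classes `z_n` of the loops that follow the flow from `x_n` to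
`x_n·t_n` and return to `x_n` along short paths (paths with diameters tending to `0`). -/
def IsLimitDirection (Φ : Flow ℝ X) (x : ℕ → X) (t : ℕ → ℝ) (d : Direction X) : Prop :=
  ∃ (σ : ∀ n, Path (Φ (t n) (x n)) (x n)) (z : ℕ → Homology₁ X),
    Tendsto (fun n => Metric.diam (Set.range (σ n))) atTop (𝓝 0) ∧
    (∀ n, IsClosingClass Φ (x n) (t n) (σ n) (z n)) ∧
    Tendsto (fun n => Direction.ofInt (z n)) atTop (𝓝 d)

/-- Fried's condition: the homology directions that are limits of closing sequences in `C_ξ` pair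
negatively with `ξ`. -/
def FriedCondition (Φ : Flow ℝ X) (ξ : Cohomology₁ X) : Prop :=
  ∀ (p : X) (x : ℕ → X) (t : ℕ → ℝ) (d : Direction X),
    IsClosingSequence Φ p x t → (∀ n, x n ∈ circulationSet Φ ξ) →
      IsLimitDirection Φ x t d → d.PairsNegatively ξ

end FlowClosing

end

noncomputable section

namespace FlowClosing

/-! Work in the group `ChainClass X` of singular 1-chains modulo boundaries: it contains `H₁`, every
path has a class there, and a cocycle representing `ξ` acts on all of it. As `X` is compact and
locally contractible, the class of a short path depends only on its end points. Hence
(`exists_cells`) there are finitely many small cells and an endomorphism `proj` of `ChainClass X`,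
the identity on `H₁`, that kills some short path between any two points of a cell and sends short
paths into a finite set. So `F(x,t) = ξ(proj(flowClass x t))` is an additive cocycle over the flow
that equals `⟨ξ, z⟩` whenever the trajectory returns to its cell and is closed up there.

(B) implies Fried: by (B), `F ≤ -1` on every long piece of trajectory in `C_ξ` that returns to its
cell. A pigeonhole argument on the cells gives `F ≤ K' - c t` (`exists_linear_decay`). Along a
closing sequence, `⟨ξ, z_n⟩ ≤ -c t_n` infinitely often for some `c > 0`. If the times are bounded,
this comes instead from a periodic orbit through the base point, which lies in `C_ξ` because
isolation of `R_ξ` makes `C_ξ` closed. Any real functional extended to `ChainClass X` is at most `3K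
t_n` on `z_n` for large `n` (`Cells.exists_growth_bound`). These rates keep such `z_n` outside an
open cone around any vector with `⟨ξ, v⟩ ≥ 0`, so it cannot represent the limit direction.

Fried implies (B): if (B) fails at every scale, there are ever finer cycles in `C_ξ` with `⟨ξ, z⟩ ≥
0`. Compactness of `X` and of `D_X` (as `H₁` is finitely generated) yields a closing sequence whose
limit direction violates Fried's condition. -/

theorem _root_.Submodule.eq_top_of_linearMap_ext {R C ι : Type} [Ring R] [AddCommGroup C]
    [Module R C] (s : ι → C)
    (hext : ∀ {M : Type} [AddCommGroup M] [Module R M] (φ ψ : C →ₗ[R] M),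
      (∀ i, φ (s i) = ψ (s i)) → φ = ψ)
    (S : Submodule R C) (h : ∀ i, s i ∈ S) : S = ⊤ := by
  rw [← S.ker_mkQ, LinearMap.ker_eq_top]
  refine hext _ _ fun i => ?_
  rw [LinearMap.zero_apply, Submodule.mkQ_apply, Submodule.Quotient.mk_eq_zero]
  exact h i

/-! ### Singular chains as a free group on simplices -/

section Simplices

variable {X Y : Type} [TopologicalSpace X] [TopologicalSpace Y]

/-- A singular simplex as a singular chain. -/
def simplexChain {n : ℕ} (f : C(stdSimplex ℝ (Fin (n + 1)), X)) : (singularComplex X).X n :=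
  ((TopCat.toSSet.obj (TopCat.of X)).ιChainComplex (R := ModuleCat.of ℤ ℤ) (n := n)
    (((TopCat.of X).toSSetObjEquiv _).symm f)).hom (1 : ℤ)

theorem pathChain_eq_simplexChain {x y : X} (γ : Path x y) :
    pathChain γ = simplexChain (n := 1)
      (γ.toContinuousMap.comp (stdSimplexHomeomorphUnitInterval : C(_, _))) := rfl

theorem d_simplexChain {n : ℕ} (f : C(stdSimplex ℝ (Fin (n + 2)), X)) :
    ((singularComplex X).d (n + 1) n).hom (simplexChain f) =
      ∑ i : Fin (n + 2), (-1 : ℤ) ^ (i : ℕ) •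
        simplexChain (f.comp ⟨stdSimplex.map i.succAbove, stdSimplex.continuous_map _⟩) := by
  have h := congrArg (fun g => g.hom (1 : ℤ))
    ((TopCat.toSSet.obj (TopCat.of X)).ιChainComplex_d (R := ModuleCat.of ℤ ℤ) (n := n)
      (((TopCat.of X).toSSetObjEquiv _).symm f))
  refine h.trans ?_
  simp only [ModuleCat.hom_sum, ModuleCat.hom_smul, LinearMap.sum_apply, LinearMap.smul_apply]
  rfl

theorem map_simplexChain {n : ℕ} (g : C(X, Y)) (f : C(stdSimplex ℝ (Fin (n + 1)), X)) :
    ((singularMap g).f n).hom (simplexChain f) = simplexChain (g.comp f) :=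
  congrArg (fun g => g.hom (1 : ℤ))
    (SSet.ι_chainComplexMap_f _ _ (TopCat.toSSet.map (TopCat.ofHom g)) (ModuleCat.of ℤ ℤ)
      (((TopCat.of X).toSSetObjEquiv (Opposite.op (SimplexCategory.mk n))).symm f))

theorem chain_linearMap_ext {n : ℕ} {M : Type} [AddCommGroup M] [Module ℤ M]
    {φ ψ : (singularComplex X).X n →ₗ[ℤ] M}
    (h : ∀ f : C(stdSimplex ℝ (Fin (n + 1)), X), φ (simplexChain f) = ψ (simplexChain f)) :
    φ = ψ := by
  have : ModuleCat.ofHom φ = ModuleCat.ofHom ψ := by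
    refine SSet.chainComplex_hom_ext fun x => ?_
    refine ModuleCat.hom_ext (LinearMap.ext_ring ?_)
    exact h ((TopCat.of X).toSSetObjEquiv _ x)
  exact congrArg ModuleCat.Hom.hom this

theorem eq_top_of_simplexChain_mem {n : ℕ} (S : Submodule ℤ ((singularComplex X).X n))
    (h : ∀ f : C(stdSimplex ℝ (Fin (n + 1)), X), simplexChain f ∈ S) : S = ⊤ :=
  Submodule.eq_top_of_linearMap_ext simplexChain (fun _ _ => chain_linearMap_ext) S h

/-- The chain group is a coproduct of copies of `ℤ` indexed by the simplices. This is what turns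
functions on points into 0-cochains. -/
theorem exists_chain_linearMap {n : ℕ} {M : Type} [AddCommGroup M] [Module ℤ M]
    (τ : C(stdSimplex ℝ (Fin (n + 1)), X) → M) :
    ∃ φ : (singularComplex X).X n →ₗ[ℤ] M, ∀ f, φ (simplexChain f) = τ f := by
  let c := Limits.Cofan.mk (ModuleCat.of ℤ M)
    fun x : (TopCat.toSSet.obj (TopCat.of X)).obj (Opposite.op (SimplexCategory.mk n)) =>
      (ModuleCat.ofHom (LinearMap.toSpanSingleton ℤ M (τ ((TopCat.of X).toSSetObjEquiv _ x))) :
        ModuleCat.of ℤ ℤ ⟶ ModuleCat.of ℤ M)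
  refine ⟨(((TopCat.toSSet.obj (TopCat.of X)).isColimitChainComplexXCofan
    (ModuleCat.of ℤ ℤ) n).desc c).hom, fun f => ?_⟩
  have h := congrArg (fun g => g.hom (1 : ℤ))
    (((TopCat.toSSet.obj (TopCat.of X)).isColimitChainComplexXCofan (ModuleCat.of ℤ ℤ) n).fac c
      ⟨((TopCat.of X).toSSetObjEquiv _).symm f⟩)
  refine h.trans ?_
  exact LinearMap.toSpanSingleton_apply_one ℤ M (τ f)

end Simplices

/-! ### Paths modulo boundaries -/

section PathClasses

variable {X Y : Type} [TopologicalSpace X] [TopologicalSpace Y]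

/-- The group of singular `1`-chains modulo boundaries. -/
abbrev ChainClass (X : Type) [TopologicalSpace X] : ModuleCat.{0} ℤ :=
  (singularComplex X).opcycles 1

/-- The class of a `1`-chain modulo boundaries. -/
def chainClass : (singularComplex X).X 1 →+ ChainClass X :=
  ((singularComplex X).pOpcycles 1).hom.toAddMonoidHom

/-- The class of a path in the group of `1`-chains modulo boundaries. -/
def pathClass {x y : X} (γ : Path x y) : ChainClass X := chainClass (pathChain γ)

/-- The inclusion of the first homology group into the group of chains modulo boundaries. -/
def homologyIncl (X : Type) [TopologicalSpace X] : Homology₁ X →+ ChainClass X :=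
  ((singularComplex X).homologyι 1).hom.toAddMonoidHom

/-- A point as a singular `0`-chain. -/
def pointChain (x : X) : (singularComplex X).X 0 := simplexChain (n := 0) (ContinuousMap.const _ x)

theorem chainClass_d (c : (singularComplex X).X 2) :
    chainClass (((singularComplex X).d 2 1).hom c) = 0 :=
  congrArg (fun g => g.hom c) ((singularComplex X).d_pOpcycles 2 1)

theorem chainClass_surjective : Function.Surjective (chainClass (X := X)) :=
  (ModuleCat.epi_iff_surjective ((singularComplex X).pOpcycles 1)).1 inferInstance

theorem homologyIncl_injective : Function.Injective (homologyIncl X) :=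
  (ModuleCat.mono_iff_injective ((singularComplex X).homologyι 1)).1 inferInstance

theorem homologyIncl_homologyπ (w : (singularComplex X).cycles 1) :
    homologyIncl X (((singularComplex X).homologyπ 1).hom w) =
      chainClass (((singularComplex X).iCycles 1).hom w) :=
  congrArg (fun g => g.hom w) ((singularComplex X).homology_π_ι 1)

theorem IsHomologyClass.homologyIncl_eq {c : (singularComplex X).X 1} {z : Homology₁ X}
    (h : IsHomologyClass c z) : homologyIncl X z = chainClass c := by
  obtain ⟨w, rfl, rfl⟩ := h
  exact homologyIncl_homologyπ w

theorem exists_isHomologyClass {c : (singularComplex X).X 1}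
    (h : ((singularComplex X).d 1 0).hom c = 0) : ∃ z, IsHomologyClass c z := by
  let k : ModuleCat.of ℤ ℤ ⟶ (singularComplex X).X 1 :=
    ModuleCat.ofHom (LinearMap.toSpanSingleton ℤ _ c)
  have hk : k ≫ (singularComplex X).d 1 0 = 0 := by
    refine ModuleCat.hom_ext (LinearMap.ext_ring ?_)
    exact Eq.trans (congrArg ((singularComplex X).d 1 0).hom
      (LinearMap.toSpanSingleton_apply_one ℤ _ c)) h
  refine ⟨_, ((singularComplex X).liftCycles k 0 (by simp) hk).hom 1, ?_, rfl⟩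
  refine (congrArg (fun g => g.hom (1 : ℤ)) ((singularComplex X).liftCycles_i k 0 _ hk)).trans ?_
  exact LinearMap.toSpanSingleton_apply_one ℤ _ c

theorem d_pathChain {x y : X} (γ : Path x y) :
    ((singularComplex X).d 1 0).hom (pathChain γ) = pointChain y - pointChain x := by
  rw [pathChain_eq_simplexChain, d_simplexChain, Fin.sum_univ_two]
  -- The face with index `i` omits vertex `i`, so face `0` is the end of the path and face `1` its
  -- start.
  have h0 : ∀ (i : Fin 2) (z : stdSimplex ℝ (Fin 1)),
      stdSimplexHomeomorphUnitInterval (stdSimplex.map i.succAbove z) = if i = 0 then 1 else 0 := by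
    intro i z
    obtain rfl := Subsingleton.elim z (stdSimplex.vertex 0)
    rw [stdSimplex.map_vertex]
    fin_cases i
    · exact stdSimplexHomeomorphUnitInterval_one
    · exact stdSimplexHomeomorphUnitInterval_zero
  have h1 : ∀ (i : Fin 2) (p : X), γ (if i = 0 then 1 else 0) = p →
      (γ.toContinuousMap.comp (stdSimplexHomeomorphUnitInterval : C(stdSimplex ℝ (Fin 2), _))).comp
        ⟨stdSimplex.map (X := Fin 1) i.succAbove, stdSimplex.continuous_map _⟩ = ContinuousMap.const _ p := by
    rintro i p rfl
    ext z
    exact congrArg γ (h0 i z)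
  rw [h1 0 y (by simp), h1 1 x (by simp)]
  simp [pointChain, sub_eq_add_neg]

theorem exists_simplexChain_eq_pathChain (f : C(stdSimplex ℝ (Fin 2), X)) :
    ∃ (x y : X) (γ : Path x y), simplexChain (n := 1) f = pathChain γ := by
  refine ⟨_, _, ⟨f.comp (stdSimplexHomeomorphUnitInterval.symm : C(_, _)), rfl, rfl⟩, ?_⟩
  rw [pathChain_eq_simplexChain]
  congr 1
  ext z
  exact congrArg f (stdSimplexHomeomorphUnitInterval.symm_apply_apply z).symm

theorem eq_top_of_pathClass_mem (S : AddSubgroup (ChainClass X))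
    (h : ∀ (x y : X) (γ : Path x y), pathClass γ ∈ S) : S = ⊤ := by
  let S' : Submodule ℤ ((singularComplex X).X 1) :=
    { S.comap chainClass with
      smul_mem' := fun n c hc => by
        have := (S.comap chainClass).zsmul_mem hc n
        rwa [← int_smul_eq_zsmul] at this }
  have hS' : S' = ⊤ := by
    refine eq_top_of_simplexChain_mem S' fun f => ?_
    obtain ⟨x, y, γ, hγ⟩ := exists_simplexChain_eq_pathChain f
    rw [hγ]
    exact h _ _ γ
  rw [eq_top_iff]
  intro q _
  obtain ⟨c, rfl⟩ := chainClass_surjective q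
  have : c ∈ S' := hS' ▸ Submodule.mem_top
  exact this

/-- The boundary map factors through `ChainClass X`; compose it with the homomorphism on 0-chains
that extends `τ`. Subtracting such a map changes the values on paths but not on homology. -/
theorem exists_boundaryHom {A : Type} [AddCommGroup A] (τ : X → A) :
    ∃ t : ChainClass X →+ A, (∀ (x y : X) (γ : Path x y), t (pathClass γ) = τ y - τ x) ∧
      ∀ z, t (homologyIncl X z) = 0 := by
  obtain ⟨φ, hφ⟩ := exists_chain_linearMap (X := X) (n := 0) (fun f => τ (f default))
  refine ⟨φ.toAddMonoidHom.comp ((singularComplex X).fromOpcycles 1 0).hom.toAddMonoidHom,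
    fun x y γ => ?_, fun z => ?_⟩
  · have := congrArg (fun g => g.hom (pathChain γ)) ((singularComplex X).p_fromOpcycles 1 0)
    refine (congrArg φ (this.trans (d_pathChain γ))).trans ?_
    rw [map_sub, pointChain, pointChain, hφ, hφ]
    rfl
  · have := congrArg (fun g => g.hom z) ((singularComplex X).homologyι_comp_fromOpcycles 1 0)
    exact (congrArg φ this).trans (map_zero φ)

theorem exists_evalHom (φ : cocycles₁ X) :
    ∃ f : ChainClass X →+ ℤ, (∀ c, f (chainClass c) = φ.1 c) ∧
      ∀ z, pairing (Submodule.Quotient.mk φ) z = f (homologyIncl X z) := by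
  refine ⟨((singularComplex X).descOpcycles (ModuleCat.ofHom φ.1) 2 (by simp)
    (d_comp_cocycle φ)).hom.toAddMonoidHom, fun c => ?_, fun z => rfl⟩
  exact congrArg (fun g => g.hom c) ((singularComplex X).p_descOpcycles (ModuleCat.ofHom φ.1) 2
    (by simp) (d_comp_cocycle φ))

/-- The image of the straight segment from `a` to `b` under a map. -/
def segPath {E : Type} [AddCommGroup E] [Module ℝ E] [TopologicalSpace E]
    [IsTopologicalAddGroup E] [ContinuousSMul ℝ E] (f : C(E, X)) (a b : E) :
    Path (f a) (f b) where
  toFun s := f ((1 - (s : ℝ)) • a + (s : ℝ) • b)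
  continuous_toFun := by fun_prop
  source' := by simp
  target' := by simp

theorem sum_stdSimplex_map {E : Type} [AddCommGroup E] [Module ℝ E] {m n : ℕ}
    (f : Fin m → Fin n) (z : stdSimplex ℝ (Fin m)) (v : Fin n → E) :
    ∑ j, (stdSimplex.map f z) j • v j = ∑ i, z i • v (f i) := by
  simp only [stdSimplex.map_coe, FunOnFinite.linearMap_apply_apply, Finset.sum_smul]
  rw [← Finset.sum_fiberwise Finset.univ f]
  refine Finset.sum_congr rfl fun j _ => Finset.sum_congr rfl fun i hi => ?_
  rw [(Finset.mem_filter.1 hi).2]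

/-- The three segments bound the image of the affine, possibly degenerate, triangle `a b c`. With `E
= ℝ` this subdivides curves; with `E = ℝ × ℝ` it handles homotopies. -/
theorem pathClass_segPath_add {E : Type} [AddCommGroup E] [Module ℝ E] [TopologicalSpace E]
    [IsTopologicalAddGroup E] [ContinuousSMul ℝ E] (f : C(E, X)) (a b c : E) :
    pathClass (segPath f a b) + pathClass (segPath f b c) = pathClass (segPath f a c) := by
  let T : C(stdSimplex ℝ (Fin 3), X) :=
    ⟨fun z => f (∑ j, z j • (![a, b, c] : Fin 3 → E) j), by
      refine f.continuous.comp (continuous_finsetSum _ fun j _ => Continuous.smul ?_ continuous_const)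
      exact (continuous_apply j).comp continuous_subtype_val⟩
  have key : ∀ (i : Fin 3) (p q : E), ![a, b, c] (i.succAbove 0) = p →
      ![a, b, c] (i.succAbove 1) = q →
      simplexChain (T.comp ⟨stdSimplex.map i.succAbove, stdSimplex.continuous_map _⟩) =
        pathChain (segPath f p q) := by
    rintro i p q rfl rfl
    rw [pathChain_eq_simplexChain]
    congr 1
    ext z
    change f (∑ j, (stdSimplex.map i.succAbove z) j • (![a, b, c] : Fin 3 → E) j) =
      f ((1 - z 1) • _ + z 1 • _)
    rw [sum_stdSimplex_map, Fin.sum_univ_two]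
    have : z 0 = 1 - z 1 := by
      have := z.2.2
      rw [Fin.sum_univ_two] at this
      exact eq_sub_of_add_eq this
    rw [this]
  have h := chainClass_d (simplexChain T)
  rw [d_simplexChain, Fin.sum_univ_three, key 0 b c rfl rfl, key 1 a c rfl rfl,
    key 2 a b rfl rfl] at h
  simp only [map_add, map_zsmul] at h
  simp only [Fin.val_zero, Fin.val_one, Fin.val_two, pow_zero, one_smul, pow_one,
    even_two, Even.neg_pow, one_pow] at h
  rw [← sub_eq_zero, ← h]
  simp only [pathClass]
  abel

/-- Paths with the same underlying function have the same class. -/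
theorem pathClass_congr {x y x' y' : X} {γ : Path x y} {γ' : Path x' y'}
    (h : ∀ s, γ s = γ' s) : pathClass γ = pathClass γ' := by
  rw [pathClass, pathClass, pathChain_eq_simplexChain, pathChain_eq_simplexChain]
  congr 2
  ext z
  exact h _

theorem pathClass_segPath_self {E : Type} [AddCommGroup E] [Module ℝ E] [TopologicalSpace E]
    [IsTopologicalAddGroup E] [ContinuousSMul ℝ E] (f : C(E, X)) (a : E) :
    pathClass (segPath f a a) = 0 :=
  add_eq_left.1 (pathClass_segPath_add f a a a)

theorem pathClass_eq_zero_of_const {x y p : X} (γ : Path x y) (h : ∀ s, γ s = p) :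
    pathClass γ = 0 := by
  rw [← pathClass_segPath_self (ContinuousMap.const ℝ p) 0]
  exact pathClass_congr h

/-- If the inclusion of `W` in `X` is homotopic to a constant map, the class of a path inside `W`
is the difference of a potential at its end points. -/
theorem exists_potential_of_nullhomotopic {W : Set X}
    (hW : (⟨((↑) : W → X), continuous_subtype_val⟩ : C(W, X)).Nullhomotopic) :
    ∃ τ : X → ChainClass X, ∀ (x y : X) (γ : Path x y), Set.range γ ⊆ W →
      pathClass γ = τ y - τ x := by
  classical
  obtain ⟨p, ⟨H⟩⟩ := hW
  let L (w : W) : Path (w : X) p :=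
    ⟨⟨fun s => H (s, w), by fun_prop⟩, by simp, by simp⟩
  refine ⟨fun x => if h : x ∈ W then -pathClass (L ⟨x, h⟩) else 0, fun x y γ hγ => ?_⟩
  have hx : x ∈ W := hγ ⟨0, γ.source⟩
  have hy : y ∈ W := hγ ⟨1, γ.target⟩
  simp only [dif_pos hx, dif_pos hy]
  -- The homotopy applied to `γ`, clamped so that it is defined on the whole plane. The sides of the
  -- unit square are `γ`, the two tracks `L` and a constant path; the diagonal cuts it into two
  -- triangles.
  let f : C(ℝ × ℝ, X) := ⟨fun q => H (Set.projIcc 0 1 zero_le_one q.1,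
    ⟨γ (Set.projIcc 0 1 zero_le_one q.2), hγ ⟨_, rfl⟩⟩), by
      refine H.continuous.comp (Continuous.prodMk ?_ (Continuous.subtype_mk ?_ _))
      · exact continuous_projIcc.comp continuous_fst
      · exact γ.continuous.comp (continuous_projIcc.comp continuous_snd)⟩
  have h1 : pathClass γ = pathClass (segPath f (0, 0) (0, 1)) := pathClass_congr fun s => by
    simp [segPath, f]
  have h2 : pathClass (L ⟨x, hx⟩) = pathClass (segPath f (0, 0) (1, 0)) :=
    pathClass_congr fun s => by simp [segPath, f, L]
  have h3 : pathClass (L ⟨y, hy⟩) = pathClass (segPath f (0, 1) (1, 1)) :=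
    pathClass_congr fun s => by simp [segPath, f, L]
  have h4 : pathClass (segPath f (1, 0) (1, 1)) = 0 :=
    pathClass_eq_zero_of_const (p := p) _ fun s => by simp [segPath, f]
  have h5 := pathClass_segPath_add f (0, 0) (1, 0) (1, 1)
  have h6 := pathClass_segPath_add f (0, 0) (0, 1) (1, 1)
  rw [h4, add_zero, ← h6] at h5
  rw [h1, h2, h3, h5]
  abel

end PathClasses

/-! ### Compactness and local contractibility of polyhedra -/

section Polyhedra

/-- The finitely many simplices that miss `x` have a closed union, so a small ball around `x` meets
only simplices containing `x`. These are convex, hence the polyhedron is star-shaped about `x`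
inside the ball. -/
theorem stronglyLocallyContractibleSpace_space {m : ℕ}
    (K : Geometry.SimplicialComplex ℝ (EuclideanSpace ℝ (Fin m))) (hK : K.faces.Finite) :
    StronglyLocallyContractibleSpace K.space := by
  have key : ∀ x : K.space, ∃ r₀ : ℝ, 0 < r₀ ∧ ∀ r, 0 < r → r ≤ r₀ →
      StarConvex ℝ (x : EuclideanSpace ℝ (Fin m)) (K.space ∩ Metric.ball x.1 r) := by
    intro x
    have hcl : IsClosed (⋃ s ∈ {s ∈ K.faces | x.1 ∉ convexHull ℝ (s : Set (EuclideanSpace ℝ (Fin m)))},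
        convexHull ℝ (s : Set (EuclideanSpace ℝ (Fin m)))) :=
      (hK.subset (Set.sep_subset _ _)).isClosed_biUnion fun s _ =>
        (s.finite_toSet.isCompact_convexHull (𝕜 := ℝ)).isClosed
    have hx : x.1 ∈ (⋃ s ∈ {s ∈ K.faces | x.1 ∉ convexHull ℝ (s : Set (EuclideanSpace ℝ (Fin m)))},
        convexHull ℝ (s : Set (EuclideanSpace ℝ (Fin m))))ᶜ := by
      simp only [Set.mem_compl_iff, Set.mem_iUnion, not_exists]
      exact fun s hs => hs.2
    obtain ⟨r₀, hr₀, hsub⟩ := Metric.isOpen_iff.1 hcl.isOpen_compl _ hx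
    refine ⟨r₀, hr₀, fun r hr hr' y ⟨hyK, hyB⟩ a b ha hb hab => ⟨?_, ?_⟩⟩
    · obtain ⟨s, hs, hys⟩ := K.mem_space_iff.1 hyK
      have hxs : x.1 ∈ convexHull ℝ (s : Set (EuclideanSpace ℝ (Fin m))) := by
        by_contra hxs
        exact hsub (Metric.ball_subset_ball hr' hyB) (Set.mem_biUnion ⟨hs, hxs⟩ hys)
      exact K.mem_space_iff.2 ⟨s, hs, convex_convexHull ℝ _ hxs hys ha hb hab⟩
    · exact convex_ball x.1 r (Metric.mem_ball_self hr) hyB ha hb hab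
  choose r₀ hr₀ hstar using key
  refine StronglyLocallyContractibleSpace.of_bases
    (p := fun x r => 0 < r ∧ r ≤ r₀ x) (s := fun x r => Metric.ball x r) (fun x => ?_) ?_
  · refine Metric.nhds_basis_ball.to_hasBasis (fun r hr => ?_) fun r hr => ⟨r, hr.1, subset_rfl⟩
    exact ⟨min r (r₀ x), ⟨lt_min hr (hr₀ x), min_le_right _ _⟩,
      Metric.ball_subset_ball (min_le_left _ _)⟩
  · intro x r ⟨hr, hr'⟩
    have h := (hstar x r hr hr').contractibleSpace ⟨x, x.2, Metric.mem_ball_self hr⟩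
    let e : Metric.ball x r ≃ₜ (K.space ∩ Metric.ball x.1 r : Set _) :=
      { toFun := fun y => ⟨y.1.1, y.1.2, y.2⟩
        invFun := fun y => ⟨⟨y.1, y.2.1⟩, y.2.2⟩
        left_inv := fun _ => rfl
        right_inv := fun _ => rfl
        continuous_toFun := by fun_prop
        continuous_invFun := by fun_prop }
    exact e.contractibleSpace_iff.2 h

theorem isCompact_space {m : ℕ}
    (K : Geometry.SimplicialComplex ℝ (EuclideanSpace ℝ (Fin m))) (hK : K.faces.Finite) :
    IsCompact K.space :=
  hK.isCompact_biUnion fun s _ => s.finite_toSet.isCompact_convexHull (𝕜 := ℝ)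

variable {X : Type} [TopologicalSpace X]

theorem IsFinitePolyhedron.compactSpace (hX : IsFinitePolyhedron X) : CompactSpace X := by
  obtain ⟨m, K, hK, ⟨e⟩⟩ := hX
  have := isCompact_iff_compactSpace.1 (isCompact_space K hK)
  exact e.symm.compactSpace

theorem IsFinitePolyhedron.stronglyLocallyContractibleSpace (hX : IsFinitePolyhedron X) :
    StronglyLocallyContractibleSpace X := by
  obtain ⟨m, K, hK, ⟨e⟩⟩ := hX
  have := stronglyLocallyContractibleSpace_space K hK
  exact e.isOpenEmbedding.stronglyLocallyContractibleSpace

end Polyhedra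

/-! ### Classes of short paths -/

section LocalClasses

variable {X : Type} [MetricSpace X]

/-- Contractible neighbourhoods carry potentials; a Lebesgue number makes the radius uniform. -/
theorem exists_ball_potential [CompactSpace X] [StronglyLocallyContractibleSpace X] :
    ∃ r : ℝ, 0 < r ∧ ∀ p : X, ∃ τ : X → ChainClass X, ∀ (x y : X) (γ : Path x y),
      Set.range γ ⊆ Metric.ball p r → pathClass γ = τ y - τ x := by
  have h : ∀ x : X, ∃ W ∈ 𝓝 x, ContractibleSpace W := fun x => by
    obtain ⟨W, ⟨hW, hc⟩, -⟩ := (contractible_basis x).mem_iff.1 univ_mem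
    exact ⟨W, hW, hc⟩
  choose W hW hc using h
  obtain ⟨r, hr, hball⟩ := lebesgue_number_lemma_of_metric (isCompact_univ (X := X))
    (fun x => isOpen_interior (s := W x))
    (fun x _ => Set.mem_iUnion.2 ⟨x, mem_interior_iff_mem_nhds.2 (hW x)⟩)
  refine ⟨r, hr, fun p => ?_⟩
  obtain ⟨i, hi⟩ := hball p trivial
  have hn : (⟨((↑) : W i → X), continuous_subtype_val⟩ : C(W i, X)).Nullhomotopic :=
    (id_nullhomotopic (W i)).comp_right (⟨((↑) : W i → X), continuous_subtype_val⟩ : C(W i, X))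
  obtain ⟨τ, hτ⟩ := exists_potential_of_nullhomotopic hn
  exact ⟨τ, fun x y γ hγ => hτ x y γ (hγ.trans (hi.trans interior_subset))⟩

theorem exists_short_path [CompactSpace X] [StronglyLocallyContractibleSpace X] {ε : ℝ}
    (hε : 0 < ε) : ∃ δ : ℝ, 0 < δ ∧ ∀ x y : X, dist x y < δ →
      ∃ γ : Path x y, Set.range γ ⊆ Metric.ball x ε := by
  have h : ∀ x : X, ∃ W ∈ 𝓝 x, IsPathConnected W ∧ W ⊆ Metric.ball x (ε / 2) := fun x => by
    obtain ⟨W, ⟨hW, hc⟩, hsub⟩ := (path_connected_basis x).mem_iff.1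
      (Metric.ball_mem_nhds x (half_pos hε))
    exact ⟨W, hW, hc, hsub⟩
  choose W hW hc hsub using h
  obtain ⟨r, hr, hball⟩ := lebesgue_number_lemma_of_metric (isCompact_univ (X := X))
    (fun x => isOpen_interior (s := W x))
    (fun x _ => Set.mem_iUnion.2 ⟨x, mem_interior_iff_mem_nhds.2 (hW x)⟩)
  refine ⟨r, hr, fun x y hxy => ?_⟩
  obtain ⟨i, hi⟩ := hball x trivial
  have hx : x ∈ W i := interior_subset (hi (Metric.mem_ball_self hr))
  have hy : y ∈ W i := interior_subset (hi (by rwa [Metric.mem_ball, dist_comm]))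
  obtain ⟨γ, hγ⟩ := (hc i).joinedIn x hx y hy
  refine ⟨γ, ?_⟩
  rintro _ ⟨s, rfl⟩
  have h1 := hsub i (hγ s)
  have h2 := hsub i hx
  rw [Metric.mem_ball] at *
  linarith [dist_triangle_right (γ s) x i]

variable (X) in
/-- The classes of short paths: `cls x y` is the common class of all paths from `x` to `y` inside
balls of radius `rad`. -/
structure ShortClasses where
  /-- the radius of the balls -/
  rad : ℝ
  rad_pos : 0 < rad
  /-- the class of the short paths from `x` to `y` -/
  cls : X → X → ChainClass X
  pathClass_eq : ∀ (p x y : X) (γ : Path x y), Set.range γ ⊆ Metric.ball p rad →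
    pathClass γ = cls x y
  cls_add : ∀ p x y z : X, x ∈ Metric.ball p rad → y ∈ Metric.ball p rad →
    z ∈ Metric.ball p rad → cls x y + cls y z = cls x z

/-- Between nearby points choose a short path. Near any `p` the chosen paths stay in a ball with a
potential `τ`, so `cls x y = τ y - τ x` there, which gives both independence of the path and
additivity. -/
theorem exists_shortClasses [CompactSpace X] [StronglyLocallyContractibleSpace X] :
    Nonempty (ShortClasses X) := by
  classical
  obtain ⟨r, hr, hpot⟩ := exists_ball_potential (X := X)
  obtain ⟨δ, hδ, hpath⟩ := exists_short_path (X := X) (half_pos hr)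
  choose γ hγ using hpath
  let cls : X → X → ChainClass X := fun x y =>
    -- The value `0` is never used: points of a common ball of radius at most `δ / 2` are closer
    -- than `δ`.
    if h : dist x y < δ then pathClass (γ x y h) else 0
  have key : ∀ p : X, ∃ τ : X → ChainClass X, (∀ (x y : X) (γ : Path x y),
      Set.range γ ⊆ Metric.ball p r → pathClass γ = τ y - τ x) ∧
      ∀ x y, x ∈ Metric.ball p (min (δ / 2) (r / 2)) → y ∈ Metric.ball p (min (δ / 2) (r / 2)) →
        cls x y = τ y - τ x := by
    intro p
    obtain ⟨τ, hτ⟩ := hpot p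
    refine ⟨τ, hτ, fun x y hx hy => ?_⟩
    rw [Metric.mem_ball] at hx hy
    have hxy : dist x y < δ := by
      linarith [dist_triangle_right x y p, min_le_left (δ / 2) (r / 2)]
    simp only [cls, dif_pos hxy]
    refine hτ x y _ ((hγ x y hxy).trans ?_)
    refine Metric.ball_subset_ball' ?_
    linarith [min_le_right (δ / 2) (r / 2)]
  refine ⟨⟨min (δ / 2) (r / 2), lt_min (half_pos hδ) (half_pos hr), cls, ?_, ?_⟩⟩
  · intro p x y γ hγ
    obtain ⟨τ, hτ, hcls⟩ := key p
    rw [hcls x y (hγ ⟨0, γ.source⟩) (hγ ⟨1, γ.target⟩)]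
    refine hτ x y γ (hγ.trans (Metric.ball_subset_ball ?_))
    linarith [min_le_right (δ / 2) (r / 2)]
  · intro p x y z hx hy hz
    obtain ⟨τ, -, hcls⟩ := key p
    rw [hcls x y hx hy, hcls y z hy hz, hcls x z hx hz]
    abel

namespace ShortClasses

variable (U : ShortClasses X)

theorem cls_self (x : X) : U.cls x x = 0 :=
  add_eq_left.1 (U.cls_add x x x x (Metric.mem_ball_self U.rad_pos)
    (Metric.mem_ball_self U.rad_pos) (Metric.mem_ball_self U.rad_pos))

theorem eventually_range_segPath_subset (f : C(ℝ, X)) (a : ℝ) {p : X} {r : ℝ}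
    (hp : f a ∈ Metric.ball p r) :
    ∀ᶠ b in 𝓝 a, Set.range (segPath f a b) ⊆ Metric.ball p r := by
  have h := f.continuous.continuousAt.preimage_mem_nhds (Metric.isOpen_ball.mem_nhds hp)
  obtain ⟨η, hη, hsub⟩ := Metric.mem_nhds_iff.1 h
  filter_upwards [Metric.ball_mem_nhds a hη] with b hb
  rintro _ ⟨s, rfl⟩
  refine hsub ?_
  exact (convex_ball a η) (Metric.mem_ball_self hη) hb (sub_nonneg.2 s.2.2) s.2.1 (by ring)

end ShortClasses

theorem pathClass_eq_segPath_extend {x y : X} (γ : Path x y) :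
    pathClass γ = pathClass (segPath ⟨γ.extend, γ.continuous_extend⟩ 0 1) :=
  pathClass_congr fun s => by simp [segPath]

/-- The classes of short paths generate the group of chains modulo boundaries. -/
theorem eq_top_of_short_pathClass_mem (S : AddSubgroup (ChainClass X)) {r : ℝ} (hr : 0 < r)
    (h : ∀ (p x y : X) (γ : Path x y), Set.range γ ⊆ Metric.ball p r → pathClass γ ∈ S) :
    S = ⊤ := by
  refine eq_top_of_pathClass_mem S fun x y γ => ?_
  rw [pathClass_eq_segPath_extend]
  set f : C(ℝ, X) := ⟨γ.extend, γ.continuous_extend⟩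
  -- Modulo `S`, the class of the initial piece up to time `s` is locally constant in `s`, so
  -- connectedness of `ℝ` replaces a subdivision.
  have hloc : IsLocallyConstant fun s =>
      (QuotientAddGroup.mk (pathClass (segPath f 0 s)) : ChainClass X ⧸ S) := by
    refine (IsLocallyConstant.iff_eventually_eq _).2 fun a => ?_
    filter_upwards [ShortClasses.eventually_range_segPath_subset f a (Metric.mem_ball_self hr)]
      with b hb
    rw [eq_comm, QuotientAddGroup.eq, ← pathClass_segPath_add f 0 a b, neg_add_cancel_left]
    exact h _ _ _ _ hb
  have := hloc.apply_eq_of_preconnectedSpace 0 1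
  simp only [QuotientAddGroup.eq, pathClass_segPath_self, neg_zero, zero_add] at this
  exact this

/-- Uniformly close paths have the same class, up to short paths between their end points. -/
theorem ShortClasses.pathClass_add_cls (U : ShortClasses X) {x y x' y' : X} (γ : Path x y)
    (γ' : Path x' y') (h : ∀ s, dist (γ s) (γ' s) < U.rad) :
    pathClass γ + U.cls y y' = U.cls x x' + pathClass γ' := by
  rw [pathClass_eq_segPath_extend γ, pathClass_eq_segPath_extend γ']
  set f : C(ℝ, X) := ⟨γ.extend, γ.continuous_extend⟩
  set g : C(ℝ, X) := ⟨γ'.extend, γ'.continuous_extend⟩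
  have hfg : ∀ s, g s ∈ Metric.ball (f s) U.rad := fun s => by
    rw [Metric.mem_ball, dist_comm]
    exact h _
  -- The defect of the asserted identity for the pieces up to time `s`; near each time all the
  -- points involved lie in one ball, where `cls` is additive.
  have hloc : IsLocallyConstant fun s =>
      pathClass (segPath f 0 s) + U.cls (f s) (g s) - pathClass (segPath g 0 s) := by
    refine (IsLocallyConstant.iff_eventually_eq _).2 fun a => ?_
    have hfa := Metric.mem_ball_self (x := f a) U.rad_pos
    filter_upwards [eventually_range_segPath_subset f a hfa,
      eventually_range_segPath_subset g a (hfg a)] with b hb hb'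
    have hfb : f b ∈ Metric.ball (f a) U.rad := hb ⟨1, (segPath f a b).target⟩
    have hgb : g b ∈ Metric.ball (f a) U.rad := hb' ⟨1, (segPath g a b).target⟩
    rw [← pathClass_segPath_add f 0 a b, ← pathClass_segPath_add g 0 a b,
      U.pathClass_eq _ _ _ _ hb, U.pathClass_eq _ _ _ _ hb']
    have h1 := U.cls_add (f a) _ _ _ hfa hfb hgb
    have h2 := U.cls_add (f a) _ _ _ hfa (hfg a) hgb
    rw [← h2] at h1
    rw [← sub_eq_zero]
    rw [← sub_eq_zero] at h1
    rw [← h1]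
    abel
  have := hloc.apply_eq_of_preconnectedSpace 0 1
  simp only [pathClass_segPath_self, zero_add, sub_zero] at this
  have e0 : U.cls (f 0) (g 0) = U.cls x x' := by simp [f, g]
  have e1 : U.cls (f 1) (g 1) = U.cls y y' := by simp [f, g]
  rw [e0, e1] at this
  rw [this]
  abel

end LocalClasses

/-! ### Vanishing of a class on a subspace in terms of potentials -/

section Restriction

variable {X : Type} [TopologicalSpace X]

theorem map_pathChain {Y : Type} [TopologicalSpace Y] (g : C(X, Y)) {x y : X} (γ : Path x y) :
    ((singularMap g).f 1).hom (pathChain γ) = pathChain (γ.map g.continuous) :=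
  map_simplexChain g _

theorem restriction_eq_zero_of_potential {B : Set X} (ξ : Cohomology₁ X)
    (τ : X → ChainClass X)
    (hτ : ∀ (x y : X) (γ : Path x y), Set.range γ ⊆ B → pathClass γ = τ y - τ x) :
    restriction ξ B = 0 := by
  obtain ⟨φ, rfl⟩ := Submodule.Quotient.mk_surjective _ ξ
  obtain ⟨f, hf, -⟩ := exists_evalHom φ
  obtain ⟨ψ, hψ⟩ := exists_chain_linearMap (X := B) (n := 0) (fun g => f (τ (g default)))
  refine (Submodule.Quotient.mk_eq_zero _).2 ⟨ψ, ?_⟩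
  refine chain_linearMap_ext fun g => ?_
  obtain ⟨x, y, γ, hγ⟩ := exists_simplexChain_eq_pathChain g
  rw [hγ]
  change ψ (((singularComplex B).d 1 0).hom (pathChain γ)) =
    φ.1 (((singularMap ⟨((↑) : B → X), continuous_subtype_val⟩).f 1).hom (pathChain γ))
  rw [d_pathChain, map_pathChain, ← hf]
  refine Eq.trans ?_ (congrArg f (hτ _ _ (γ.map continuous_subtype_val) ?_)).symm
  · rw [map_sub, map_sub, pointChain, pointChain, hψ, hψ]
    rfl
  · rintro _ ⟨s, rfl⟩
    exact (γ s).2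

theorem exists_potential_of_restriction_eq_zero {B : Set X} {φ : cocycles₁ X}
    (h : restriction (Submodule.Quotient.mk φ : Cohomology₁ X) B = 0) :
    ∃ ψ : X → ℤ, ∀ (x y : X) (γ : Path x y), Set.range γ ⊆ B →
      φ.1 (pathChain γ) = ψ y - ψ x := by
  classical
  obtain ⟨ψ, hψ⟩ := (Submodule.Quotient.mk_eq_zero _).1 h
  refine ⟨fun x => if hx : x ∈ B then ψ (pointChain ⟨x, hx⟩) else 0, fun x y γ hγ => ?_⟩
  have hx : x ∈ B := hγ ⟨0, γ.source⟩
  have hy : y ∈ B := hγ ⟨1, γ.target⟩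
  simp only [dif_pos hx, dif_pos hy]
  let γ' : Path (⟨x, hx⟩ : B) ⟨y, hy⟩ :=
    ⟨⟨fun s => ⟨γ s, hγ ⟨s, rfl⟩⟩, by fun_prop⟩, by simp, by simp⟩
  have h1 := LinearMap.congr_fun hψ (pathChain γ')
  change ψ (((singularComplex B).d 1 0).hom (pathChain γ')) =
    φ.1 (((singularMap ⟨((↑) : B → X), continuous_subtype_val⟩).f 1).hom (pathChain γ')) at h1
  rw [d_pathChain, map_pathChain, map_sub] at h1
  exact h1.symm

end Restriction

/-! ### Classes of trajectories -/

section FlowClasses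

variable {X : Type} [MetricSpace X] {Φ : Flow ℝ X}

/-- The class of a trajectory in the group of chains modulo boundaries. -/
def flowClass (Φ : Flow ℝ X) (x : X) (t : ℝ) : ChainClass X := pathClass (flowPath Φ x t)

theorem flowClass_add (x : X) (s t : ℝ) :
    flowClass Φ x (s + t) = flowClass Φ x s + flowClass Φ (Φ s x) t := by
  let f : C(ℝ, X) := ⟨fun r => Φ r x, Φ.continuous continuous_id continuous_const⟩
  have h1 : flowClass Φ x (s + t) = pathClass (segPath f 0 (s + t)) := pathClass_congr fun r => by
    simp [segPath, f, flowPath]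
  have h2 : flowClass Φ x s = pathClass (segPath f 0 s) := pathClass_congr fun r => by
    simp [segPath, f, flowPath]
  have h3 : flowClass Φ (Φ s x) t = pathClass (segPath f s (s + t)) := pathClass_congr fun r => by
    change Φ (r * t) (Φ s x) = Φ ((1 - (r : ℝ)) * s + r * (s + t)) x
    rw [← Φ.map_add]
    congr 1
    ring
  rw [h1, h2, h3, pathClass_segPath_add]

theorem flowClass_zero (x : X) : flowClass Φ x 0 = 0 := by
  have h := flowClass_add (Φ := Φ) x 0 0
  rw [Φ.map_zero_apply, add_zero] at h
  exact add_eq_left.1 h.symm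

theorem ShortClasses.flowClass_add_cls (U : ShortClasses X) {x y : X} {s t : ℝ}
    (h : ∀ r : unitInterval, dist (Φ (r * s) x) (Φ (r * t) y) < U.rad) :
    flowClass Φ x s + U.cls (Φ s x) (Φ t y) = U.cls x y + flowClass Φ y t :=
  U.pathClass_add_cls _ _ h

theorem IsClosingClass.homologyIncl_eq {x : X} {t : ℝ} {σ : Path (Φ t x) x} {z : Homology₁ X}
    (h : IsClosingClass Φ x t σ z) :
    homologyIncl X z = flowClass Φ x t + pathClass σ :=
  (IsHomologyClass.homologyIncl_eq h).trans (map_add _ _ _)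

theorem exists_isClosingClass (x : X) (t : ℝ) (σ : Path (Φ t x) x) :
    ∃ z, IsClosingClass Φ x t σ z :=
  exists_isHomologyClass (by rw [map_add, d_pathChain, d_pathChain]; abel)

theorem uniformContinuous_flow [CompactSpace X] (Φ : Flow ℝ X) (T : ℝ) {ε : ℝ} (hε : 0 < ε) :
    ∃ δ : ℝ, 0 < δ ∧ ∀ (x y : X) (s t : ℝ), |s| ≤ T → |t| ≤ T → dist s t < δ → dist x y < δ →
      dist (Φ s x) (Φ t y) < ε := by
  have hc : ContinuousOn (fun q : ℝ × X => Φ q.1 q.2) (Set.Icc (-T) T ×ˢ Set.univ) :=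
    (Φ.continuous continuous_fst continuous_snd).continuousOn
  have hu := (isCompact_Icc.prod isCompact_univ).uniformContinuousOn_of_continuous hc
  obtain ⟨δ, hδ, h⟩ := Metric.uniformContinuousOn_iff.1 hu ε hε
  refine ⟨δ, hδ, fun x y s t hs ht hst hxy => ?_⟩
  exact h (s, x) ⟨abs_le.1 hs, trivial⟩ (t, y) ⟨abs_le.1 ht, trivial⟩ (max_lt hst hxy)

/-- A single representing cocycle serves for the pairing and for all local potentials, so `ξ` can be
evaluated on paths that are not closed. -/
theorem exists_cohomologyHom (ξ : Cohomology₁ X) :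
    ∃ f : ChainClass X →+ ℤ, (∀ z, pairing ξ z = f (homologyIncl X z)) ∧
      ∀ B : Set X, restriction ξ B = 0 → ∃ ψ : X → ℤ, ∀ (x y : X) (γ : Path x y),
        Set.range γ ⊆ B → f (pathClass γ) = ψ y - ψ x := by
  obtain ⟨φ, rfl⟩ := Submodule.Quotient.mk_surjective _ ξ
  obtain ⟨f, hf, hp⟩ := exists_evalHom φ
  refine ⟨f, hp, fun B hB => ?_⟩
  obtain ⟨ψ, hψ⟩ := exists_potential_of_restriction_eq_zero hB
  exact ⟨ψ, fun x y γ hγ => (hf _).trans (hψ x y γ hγ)⟩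

variable [CompactSpace X] [StronglyLocallyContractibleSpace X]

theorem exists_isScale (ξ : Cohomology₁ X) {r : ℝ} (hr : 0 < r) :
    ∃ ε δ : ℝ, ε ≤ r ∧ δ ≤ r ∧ IsScale ξ ε δ := by
  obtain ⟨r', hr', hpot⟩ := exists_ball_potential (X := X)
  have hε : 0 < min r (r' / 2) := lt_min hr (half_pos hr')
  obtain ⟨δ, hδ, hpath⟩ := exists_short_path (X := X) hε
  refine ⟨min r (r' / 2), min r δ, min_le_left _ _, min_le_left _ _, hε, lt_min hr hδ,
    fun p => ?_, fun x y hxy => ?_⟩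
  · obtain ⟨τ, hτ⟩ := hpot p
    refine restriction_eq_zero_of_potential ξ τ fun x y γ hγ => hτ x y γ (hγ.trans ?_)
    refine Metric.ball_subset_ball ?_
    linarith [min_le_right r (r' / 2)]
  · obtain ⟨γ, hγ⟩ := hpath x y (hxy.trans_le (min_le_right _ _))
    exact ⟨γ, x, hγ⟩

end FlowClasses

/-! ### Invariance and closedness of the recurrent sets -/

section Recurrence

variable {X : Type} [MetricSpace X] {Φ : Flow ℝ X}

theorem FlowChain.zero_ne_last {δ T : ℝ} {x y : X} (c : FlowChain Φ δ T x y) :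
    (0 : Fin (c.length + 1)) ≠ Fin.last c.length :=
  fun h => c.length_pos.ne (congrArg Fin.val h)

/-- The chain obtained by applying the time-`s` map of the flow to a chain. -/
def FlowChain.shift {δ T : ℝ} {x y : X} (c : FlowChain Φ δ T x y) (s δ' : ℝ)
    (h : ∀ a b : X, dist a b < δ → dist (Φ s a) (Φ s b) < δ') :
    FlowChain Φ δ' T (Φ s x) (Φ s y) where
  length := c.length
  length_pos := c.length_pos
  pt i := Φ s (c.pt i)
  time := c.time
  pt_zero := by rw [c.pt_zero]
  pt_last := by rw [c.pt_last]
  le_time := c.le_time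
  dist_lt i := by
    rw [← Φ.map_add, add_comm, Φ.map_add]
    exact h _ _ (c.dist_lt i)

theorem map_mem_chainRecurrentSet [CompactSpace X] {x : X} (hx : x ∈ chainRecurrentSet Φ) (s : ℝ) :
    Φ s x ∈ chainRecurrentSet Φ := by
  intro δ hδ T hT
  obtain ⟨δ', hδ', h⟩ := uniformContinuous_flow Φ |s| hδ
  obtain ⟨c⟩ := hx δ' hδ' T hT
  exact ⟨c.shift s δ fun a b hab => h a b s s le_rfl le_rfl (by simpa using hδ') hab⟩

/-- Take a chain of a nearby recurrent point `y`. Follow `x` for time `T`, jump to `Φ T y`, continue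
along the chain, and end at `x` instead of `y`. -/
theorem isClosed_chainRecurrentSet [CompactSpace X] : IsClosed (chainRecurrentSet Φ) := by
  refine isClosed_of_closure_subset fun x hx δ hδ T hT => ?_
  obtain ⟨η, hη, hunif⟩ := uniformContinuous_flow Φ T (half_pos hδ)
  obtain ⟨y, hy, hxy⟩ := Metric.mem_closure_iff.1 hx (min η (δ / 2)) (lt_min hη (half_pos hδ))
  -- With `2 * T`, the first piece can be cut at time `T` and both parts still last at least `T`.
  obtain ⟨c⟩ := hy (δ / 2) (half_pos hδ) (2 * T) (by linarith)
  have hT' : |T| ≤ T := (abs_of_nonneg (by linarith)).le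
  classical
  let q : Fin (c.length + 1) → X := fun i =>
    if i = Fin.last _ then x else if i = 0 then Φ T y else c.pt i
  let t : Fin c.length → ℝ := fun i => if i.castSucc = 0 then c.time i - T else c.time i
  have hq : ∀ i : Fin c.length, Φ (t i) (q i.castSucc) = Φ (c.time i) (c.pt i.castSucc) := by
    intro i
    simp only [q, t, if_neg i.castSucc_lt_last.ne]
    split_ifs with h0
    · rw [← Φ.map_add, sub_add_cancel, h0, c.pt_zero]
    · rfl
  refine ⟨⟨c.length + 1, Nat.succ_pos _, Fin.cons x q, Fin.cons T t, rfl, ?_, ?_, ?_⟩⟩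
  · rw [← Fin.succ_last, Fin.cons_succ]
    simp [q]
  · refine Fin.cases le_rfl fun i => ?_
    simp only [Fin.cons_succ, t]
    have := c.le_time i
    split_ifs <;> linarith
  · refine Fin.cases ?_ fun i => ?_
    · have h0 : q 0 = Φ T y := by simp [q, if_neg c.zero_ne_last]
      change dist (Φ T x) (q 0) < δ
      rw [h0]
      have := hunif x y T T hT' hT' (by simpa using hη) (hxy.trans_le (min_le_left _ _))
      linarith
    · change dist (Φ (t i) (q i.castSucc)) (q i.succ) < δ
      rw [hq i]
      have h1 := c.dist_lt i
      by_cases hl : i.succ = Fin.last _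
      · have h2 : q i.succ = x := by simp [q, hl]
        rw [hl, c.pt_last] at h1
        rw [h2]
        have := hxy.trans_le (min_le_right _ _)
        linarith [dist_triangle_right (Φ (c.time i) (c.pt i.castSucc)) x y]
      · have h2 : q i.succ = c.pt i.succ := by simp [q, hl]
        rw [h2]
        linarith

theorem FlowChain.exists_isHomologyClass {δ T : ℝ} {x : X} (c : FlowChain Φ δ T x x)
    (σ : ∀ i : Fin c.length, Path (Φ (c.time i) (c.pt i.castSucc)) (c.pt i.succ)) :
    ∃ z, IsHomologyClass
      (∑ i, (pathChain (flowPath Φ (c.pt i.castSucc) (c.time i)) + pathChain (σ i))) z := by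
  refine FlowClosing.exists_isHomologyClass ?_
  rw [map_sum]
  simp only [map_add, d_pathChain, sub_add_sub_cancel']
  rw [Finset.sum_sub_distrib, sub_eq_zero]
  have h := (Fin.sum_univ_succ fun i => pointChain (c.pt i)).symm.trans
    (Fin.sum_univ_castSucc fun i => pointChain (c.pt i))
  rw [c.pt_zero, c.pt_last, add_comm] at h
  exact add_right_cancel h

/-- Moving a chain by the flow changes the `ξ`-value of each piece by a difference of the values on
the time-`s` trajectories from its two end points. Around a closed chain these differences telescope
to zero. -/
theorem map_mem_chainRecurrentSetOf [CompactSpace X] [StronglyLocallyContractibleSpace X]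
    {ξ : Cohomology₁ X} {x : X} (hx : x ∈ chainRecurrentSetOf Φ ξ) (s : ℝ) :
    Φ s x ∈ chainRecurrentSetOf Φ ξ := by
  obtain ⟨ε, δ, hscale, hchain⟩ := hx
  refine ⟨ε, δ, hscale, fun δ' hδ' hlt T hT => ?_⟩
  obtain ⟨hε, hδ, hres, -⟩ := hscale
  obtain ⟨f, hf, hpot⟩ := exists_cohomologyHom ξ
  obtain ⟨U⟩ := exists_shortClasses (X := X)
  obtain ⟨δ₀, hδ₀, hpath⟩ := exists_short_path (X := X) (lt_min U.rad_pos hε)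
  have hμ : 0 < min (min δ' δ₀) U.rad := lt_min (lt_min hδ' hδ₀) U.rad_pos
  obtain ⟨η, hη, hunif⟩ := uniformContinuous_flow Φ |s| hμ
  have hη' : 0 < min η (min δ' δ₀) := lt_min hη (lt_min hδ' hδ₀)
  obtain ⟨c, hc⟩ := hchain (min η (min δ' δ₀)) hη'
    (((min_le_right _ _).trans (min_le_left _ _)).trans_lt hlt) T hT
  have hclose : ∀ a b : X, dist a b < min η (min δ' δ₀) → ∀ r, |r| ≤ |s| →
      dist (Φ r a) (Φ r b) < min (min δ' δ₀) U.rad := fun a b hab r hr =>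
    hunif a b r r hr hr (by simpa using hη) (hab.trans_le (min_le_left _ _))
  refine ⟨c.shift s δ' fun a b hab => (hclose a b hab s le_rfl).trans_le
    ((min_le_left _ _).trans (min_le_left _ _)), fun z' hz' => ?_⟩
  obtain ⟨σ', hσ', hz'⟩ := hz'
  have hdist : ∀ i, dist (Φ (c.time i) (c.pt i.castSucc)) (c.pt i.succ) < δ₀ := fun i =>
    (c.dist_lt i).trans_le ((min_le_right _ _).trans (min_le_right _ _))
  -- The hypothesis on `c` speaks only of classes associated with it, so one must be produced, here
  -- with paths short enough for `U`.
  choose σ hσ using fun i => hpath _ _ (hdist i)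
  obtain ⟨z, hz⟩ := c.exists_isHomologyClass σ
  have hz0 := hc z ⟨σ, fun i => ⟨_, (hσ i).trans (Metric.ball_subset_ball (min_le_right _ _))⟩, hz⟩
  rw [hf, hz.homologyIncl_eq, map_sum, map_sum] at hz0
  rw [hf, hz'.homologyIncl_eq, map_sum, map_sum, ← hz0]
  have key : ∀ i : Fin c.length,
      f (chainClass (pathChain (flowPath Φ (Φ s (c.pt i.castSucc)) (c.time i)) +
        pathChain (σ' i))) =
      f (chainClass (pathChain (flowPath Φ (c.pt i.castSucc) (c.time i)) + pathChain (σ i))) +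
        (f (flowClass Φ (c.pt i.succ) s) - f (flowClass Φ (c.pt i.castSucc) s)) := by
    intro i
    set a := Φ (c.time i) (c.pt i.castSucc) with ha
    have hsa : Φ s a = Φ (c.time i) (Φ s (c.pt i.castSucc)) := by
      rw [ha, ← Φ.map_add, add_comm, Φ.map_add]
    have h1 : pathClass (σ i) = U.cls a (c.pt i.succ) :=
      U.pathClass_eq _ _ _ _ ((hσ i).trans (Metric.ball_subset_ball (min_le_left _ _)))
    -- The path `σ' i` lies only in an `ε`-ball, perhaps too large for `U`. Its `ξ`-value is still
    -- that of a short path `κ`, since both lie in a `2ε`-ball, where `ξ` vanishes.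
    have h2 : f (pathClass (σ' i)) = f (U.cls (Φ s a) (Φ s (c.pt i.succ))) := by
      have hd := hclose a _ (c.dist_lt i) s le_rfl
      obtain ⟨κ, hκ⟩ := hpath _ _ (hd.trans_le ((min_le_left _ _).trans (min_le_right _ _)))
      rw [← U.pathClass_eq _ _ _ κ (hκ.trans (Metric.ball_subset_ball (min_le_left _ _)))]
      obtain ⟨p, hp⟩ := hσ' i
      obtain ⟨ψ, hψ⟩ := hpot _ (hres p)
      have hap : Φ s a ∈ Metric.ball p ε := by
        rw [hsa]
        exact hp ⟨0, (σ' i).source⟩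
      rw [hψ _ _ κ, hψ _ _ (σ' i), hsa]
      · rfl
      · exact hp.trans (Metric.ball_subset_ball (by linarith))
      · refine hκ.trans (Metric.ball_subset_ball' ?_)
        rw [Metric.mem_ball] at hap
        linarith [min_le_right U.rad ε]
    have h3 := U.flowClass_add_cls (Φ := Φ) (x := a) (y := c.pt i.succ) (s := s) (t := s)
      fun r => (hclose a _ (c.dist_lt i) (r * s) (by
        rw [abs_mul, abs_of_nonneg r.2.1]
        exact mul_le_of_le_one_left (abs_nonneg s) r.2.2)).trans_le (min_le_right _ _)
    have h4 := (flowClass_add (Φ := Φ) (c.pt i.castSucc) s (c.time i)).symm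
    rw [add_comm s, flowClass_add, ← ha] at h4
    have h4' := congrArg f h4
    have h3' := congrArg f h3
    simp only [map_add] at h3' h4' ⊢
    change f (flowClass Φ (Φ s (c.pt i.castSucc)) (c.time i)) + f (pathClass (σ' i)) =
      f (flowClass Φ (c.pt i.castSucc) (c.time i)) + f (pathClass (σ i)) + _
    rw [h1, h2]
    linarith
  have hsum := (Fin.sum_univ_succ fun i => f (flowClass Φ (c.pt i) s)).symm.trans
    (Fin.sum_univ_castSucc fun i => f (flowClass Φ (c.pt i) s))
  rw [c.pt_zero, c.pt_last] at hsum
  have hsum' := Finset.sum_congr (rfl : (Finset.univ : Finset (Fin c.length)) = _)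
    fun i _ => key i
  rw [Finset.sum_add_distrib, Finset.sum_sub_distrib] at hsum'
  refine hsum'.trans ?_
  linarith

theorem map_mem_circulationSet [CompactSpace X] [StronglyLocallyContractibleSpace X]
    {ξ : Cohomology₁ X} {x : X} (hx : x ∈ circulationSet Φ ξ) (s : ℝ) :
    Φ s x ∈ circulationSet Φ ξ := by
  refine ⟨map_mem_chainRecurrentSet hx.1 s, fun h => hx.2 ?_⟩
  have := map_mem_chainRecurrentSetOf h (-s)
  rwa [← Φ.map_add, neg_add_cancel, Φ.map_zero_apply] at this

/-- Isolation of `R_ξ` enters the argument only through this closedness. -/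
theorem IsIsolatedInR.isClosed_circulationSet [CompactSpace X] {ξ : Cohomology₁ X}
    (h : IsIsolatedInR Φ ξ) : IsClosed (circulationSet Φ ξ) := by
  obtain ⟨U, hU, hUR⟩ := h
  have : circulationSet Φ ξ = chainRecurrentSet Φ ∩ Uᶜ := by
    rw [circulationSet, ← hUR]
    ext x
    simp only [Set.mem_sdiff, Set.mem_inter_iff, Set.mem_compl_iff]
    tauto
  rw [this]
  exact isClosed_chainRecurrentSet.inter hU.isClosed_compl

end Recurrence

/-! ### Finite cells, finiteness of homology and linear growth -/

section Cells

variable {X : Type} [MetricSpace X]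

variable (X) in
/-- A partition of `X` into finitely many cells of size `r`, with the retraction `proj` of the
chains modulo boundaries that connects the end points of a path with the centres of their cells. -/
structure Cells (r : ℝ) where
  /-- the centre of the cell of a point -/
  cell : X → X
  /-- the endomorphism that prolongs paths to the centres of the cells of their end points -/
  proj : ChainClass X →+ ChainClass X
  /-- the radius of the balls in which paths count as short -/
  rad : ℝ
  rad_pos : 0 < rad
  finite_range : (Set.range cell).Finite
  proj_homologyIncl : ∀ z, proj (homologyIncl X z) = homologyIncl X z
  exists_path : ∀ x y, cell x = cell y →
    ∃ (σ : Path x y) (p : X), Set.range σ ⊆ Metric.ball p r ∧ proj (pathClass σ) = 0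
  /-- the classes of prolonged short paths -/
  shortProj : Set (ChainClass X)
  finite_shortProj : shortProj.Finite
  proj_mem : ∀ (p x y : X) (γ : Path x y), Set.range γ ⊆ Metric.ball p rad →
    proj (pathClass γ) ∈ shortProj

/-- Assign to each point a nearby centre from a finite net and subtract the boundary homomorphism
with potential `cls (cell x) x`. A short path from `x` to `y` then becomes `cls (cell x) (cell y)`:
finitely many values, and `0` inside one cell. -/
theorem exists_cells [CompactSpace X] [StronglyLocallyContractibleSpace X] {r : ℝ} (hr : 0 < r) :
    Nonempty (Cells X r) := by
  obtain ⟨U⟩ := exists_shortClasses (X := X)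
  have hρ : 0 < U.rad / 3 := by linarith [U.rad_pos]
  obtain ⟨δ, hδ, hpath⟩ := exists_short_path (X := X) (lt_min hr hρ)
  obtain ⟨S, -, hS, hcov⟩ := finite_cover_balls_of_compact (isCompact_univ (X := X))
    (lt_min hδ hρ)
  have hcell : ∀ x : X, ∃ c ∈ S, dist c x < min δ (U.rad / 3) := fun x => by
    obtain ⟨c, hc, hx⟩ := Set.mem_iUnion₂.1 (hcov (Set.mem_univ x))
    exact ⟨c, hc, by rwa [Metric.mem_ball, dist_comm] at hx⟩
  choose cell hcS hcx using hcell
  have hc3 : ∀ x, dist (cell x) x < U.rad / 3 := fun x => (hcx x).trans_le (min_le_right _ _)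
  obtain ⟨t, ht, ht'⟩ := exists_boundaryHom (fun x => U.cls (cell x) x)
  have hproj : ∀ (p x y : X) (γ : Path x y), Set.range γ ⊆ Metric.ball p (U.rad / 3) →
      pathClass γ - t (pathClass γ) = U.cls (cell x) (cell y) := by
    intro p x y γ hγ
    have hx : dist x p < U.rad / 3 := hγ ⟨0, γ.source⟩
    have hy : dist y p < U.rad / 3 := hγ ⟨1, γ.target⟩
    have hsub : Metric.ball p (U.rad / 3) ⊆ Metric.ball p U.rad :=
      Metric.ball_subset_ball (by linarith)
    have hcxp : cell x ∈ Metric.ball p U.rad := by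
      rw [Metric.mem_ball]
      linarith [dist_triangle (cell x) x p, hc3 x]
    have hcyp : cell y ∈ Metric.ball p U.rad := by
      rw [Metric.mem_ball]
      linarith [dist_triangle (cell y) y p, hc3 y]
    rw [ht, U.pathClass_eq p x y γ (hγ.trans hsub)]
    have h1 := U.cls_add p _ _ _ hcxp (hsub hx) (hsub hy)
    have h2 := U.cls_add p _ _ _ hcxp hcyp (hsub hy)
    rw [← h2, ← eq_sub_iff_add_eq', ← sub_eq_zero] at h1
    rw [← sub_eq_zero, ← h1]
    abel
  refine ⟨⟨cell, AddMonoidHom.id _ - t, U.rad / 3, hρ, hS.subset ?_, fun z => ?_, fun x y hxy => ?_,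
    Set.image2 U.cls S S, hS.image2 _ hS, fun p x y γ hγ => ?_⟩⟩
  · rintro _ ⟨x, rfl⟩
    exact hcS x
  · rw [AddMonoidHom.sub_apply, ht', AddMonoidHom.id_apply, sub_zero]
  · obtain ⟨γ, hγ⟩ := hpath (cell x) x ((hcx x).trans_le (min_le_left _ _))
    obtain ⟨γ', hγ'⟩ := hpath (cell x) y (hxy ▸ (hcx y).trans_le (min_le_left _ _))
    have hσ : Set.range (γ.symm.trans γ') ⊆ Metric.ball (cell x) (min r (U.rad / 3)) := by
      rw [Path.trans_range, Path.symm_range]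
      exact Set.union_subset hγ hγ'
    refine ⟨γ.symm.trans γ', cell x, hσ.trans (Metric.ball_subset_ball (min_le_left _ _)), ?_⟩
    refine (hproj _ _ _ _ (hσ.trans (Metric.ball_subset_ball (min_le_right _ _)))).trans ?_
    rw [hxy, U.cls_self]
  · exact ⟨_, hcS x, _, hcS y, (hproj p x y γ hγ).symm⟩

theorem _root_.Module.Finite.of_injective_of_mem_span {R M N : Type} [Ring R] [IsNoetherianRing R]
    [AddCommGroup M] [Module R M] [AddCommGroup N] [Module R N] (i : M →ₗ[R] N)
    (hi : Function.Injective i) {S : Set N} (hS : S.Finite)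
    (h : ∀ z, i z ∈ Submodule.span R S) : Module.Finite R M := by
  have : IsNoetherian R (Submodule.span R S) := isNoetherian_span_of_finite R hS
  exact Module.Finite.of_injective (LinearMap.codRestrict _ i h)
    fun a b hab => hi (congrArg Subtype.val hab)

/-- Short paths generate all chain classes, so `proj` maps everything into the span of a finite set,
while it fixes `H₁`. -/
theorem finite_homology [CompactSpace X] [StronglyLocallyContractibleSpace X] :
    Module.Finite ℤ (Homology₁ X) := by
  obtain ⟨D⟩ := exists_cells (X := X) one_pos
  let S : Submodule ℤ (ChainClass X) := Submodule.span ℤ D.shortProj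
  have htop := eq_top_of_short_pathClass_mem (S.toAddSubgroup.comap D.proj) D.rad_pos
    fun p x y γ hγ => Submodule.subset_span (D.proj_mem p x y γ hγ)
  have hmem : ∀ z, ((singularComplex X).homologyι 1).hom z ∈ S := fun z => by
    have h : homologyIncl X z ∈ S.toAddSubgroup.comap D.proj := htop ▸ AddSubgroup.mem_top _
    rw [AddSubgroup.mem_comap, D.proj_homologyIncl] at h
    exact h
  exact Module.Finite.of_injective_of_mem_span ((singularComplex X).homologyι 1).hom
    homologyIncl_injective D.finite_shortProj hmem

/-- Trajectories of a fixed small duration `s` are short, so their projected classes lie in a finite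
set; a trajectory of duration `t` consists of `⌈t / s⌉` of them. -/
theorem Cells.exists_growth_bound [CompactSpace X] {r : ℝ} (D : Cells X r) (Φ : Flow ℝ X)
    (g : ChainClass X →+ ℝ) :
    ∃ K : ℝ, 0 < K ∧ (∀ (p x y : X) (γ : Path x y), Set.range γ ⊆ Metric.ball p D.rad →
      |g (D.proj (pathClass γ))| ≤ K) ∧
      ∀ x t, 0 ≤ t → |g (D.proj (flowClass Φ x t))| ≤ K * (t + 1) := by
  obtain ⟨K, hK⟩ := (D.finite_shortProj.image fun q => |g q|).bddAbove
  have hK1 : ∀ (p x y : X) (γ : Path x y), Set.range γ ⊆ Metric.ball p D.rad →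
      |g (D.proj (pathClass γ))| ≤ max K 1 := fun p x y γ hγ =>
    (hK ⟨_, D.proj_mem p x y γ hγ, rfl⟩).trans (le_max_left _ _)
  obtain ⟨η, hη, hunif⟩ := uniformContinuous_flow Φ 1 D.rad_pos
  have hs : 0 < min 1 (η / 2) := lt_min one_pos (half_pos hη)
  set s := min 1 (η / 2) with hsdef
  have hshort : ∀ x t, 0 ≤ t → t ≤ s → |g (D.proj (flowClass Φ x t))| ≤ max K 1 := by
    intro x t ht hts
    refine hK1 x _ _ _ ?_
    rintro _ ⟨u, rfl⟩
    have h0 : 0 ≤ u * t := mul_nonneg u.2.1 ht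
    have h1 : u * t ≤ s := (mul_le_of_le_one_left ht u.2.2).trans hts
    have := hunif x x (u * t) 0 (by rw [abs_of_nonneg h0]; exact h1.trans (min_le_left _ _))
      (by simp) (by
        rw [Real.dist_eq, sub_zero, abs_of_nonneg h0]
        linarith [min_le_right 1 (η / 2)]) (by simpa using hη)
    rwa [Φ.map_zero_apply] at this
  have hind : ∀ n : ℕ, ∀ x t, 0 ≤ t → t ≤ n * s →
      |g (D.proj (flowClass Φ x t))| ≤ n * max K 1 := by
    intro n
    induction n with
    | zero =>
      intro x t ht hts
      have : t = 0 := le_antisymm (by simpa using hts) ht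
      simp [this, flowClass_zero]
    | succ n ih =>
      intro x t ht hts
      push_cast at hts ⊢
      have hmin : t = min t s + (t - min t s) := by ring
      rw [hmin, flowClass_add, map_add, map_add]
      have h1 := hshort x (min t s) (le_min ht hs.le) (min_le_right _ _)
      have h2 := ih (Φ (min t s) x) (t - min t s) (sub_nonneg.2 (min_le_left _ _)) (by
        rcases min_cases t s with ⟨h, -⟩ | ⟨h, -⟩ <;> rw [h]
        · rw [sub_self]; positivity
        · linarith)
      linarith [abs_add_le (g (D.proj (flowClass Φ x (min t s))))
        (g (D.proj (flowClass Φ (Φ (min t s) x) (t - min t s))))]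
  have hM : 0 < max K 1 := lt_max_of_lt_right one_pos
  refine ⟨max K 1 / s, div_pos hM hs, fun p x y γ hγ => (hK1 p x y γ hγ).trans ?_,
    fun x t ht => ?_⟩
  · rw [le_div_iff₀ hs]
    exact mul_le_of_le_one_right hM.le (min_le_left _ _)
  · refine (hind ⌈t / s⌉₊ x t ht ?_).trans ?_
    · rw [← div_le_iff₀ hs]
      exact Nat.le_ceil _
    · have h1 : (⌈t / s⌉₊ : ℝ) ≤ t / s + 1 := (Nat.ceil_lt_add_one (by positivity)).le
      have h2 : t / s + 1 ≤ (t + 1) / s := by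
        rw [add_div]
        gcongr
        rw [le_div_iff₀ hs, one_mul]
        exact min_le_left _ _
      calc (⌈t / s⌉₊ : ℝ) * max K 1 ≤ (t + 1) / s * max K 1 := by gcongr; linarith
        _ = max K 1 / s * (t + 1) := by ring

end Cells

/-! ### Linear decay by pigeonhole -/

section Decay

/-- If a real sequence with increments at most `K` drops by at least `1` between two times of the
same colour, its increases are bounded by `K` times the number of colours. -/
theorem sub_le_card_mul_of_colouring {κ : Type} [DecidableEq κ] {G : ℕ → ℝ} {col : ℕ → κ} {K : ℝ}
    (hK : 0 ≤ K) (hstep : ∀ k, G (k + 1) - G k ≤ K)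
    (hcol : ∀ j k, j < k → col j = col k → G k - G j ≤ -1) (S : Finset κ) :
    ∀ a b, a ≤ b → (∀ i, a ≤ i → i ≤ b → col i ∈ S) → G b - G a ≤ S.card * K := by
  induction S using Finset.strongInduction with
  | H S ih =>
    intro a b hab hS
    -- Jump from `a` to the last index `j` of the same colour, which costs nothing. After one more
    -- step that colour never recurs, so induction applies to the other colours.
    let I := (Finset.Icc a b).filter fun i => col i = col a
    have hI : I.Nonempty := ⟨a, by simp [I, hab]⟩
    obtain ⟨hjI, hjc⟩ := Finset.mem_filter.1 (I.max'_mem hI)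
    set j := I.max' hI with hj
    obtain ⟨haj, hjb⟩ := Finset.mem_Icc.1 hjI
    have h1 : G j - G a ≤ 0 := by
      rcases haj.eq_or_lt with h | h
      · rw [← h, sub_self]
      · linarith [hcol a j h hjc.symm]
    rcases hjb.eq_or_lt with h | h
    · rw [← h]
      exact h1.trans (by positivity)
    · have haS : col a ∈ S := hS a le_rfl hab
      have h2 := ih (S.erase (col a)) (Finset.erase_ssubset haS) (j + 1) b h fun i hi hib => by
        refine Finset.mem_erase.2 ⟨fun hc => ?_, hS i (by lia) hib⟩
        have : i ≤ j := I.le_max' i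
          (Finset.mem_filter.2 ⟨Finset.mem_Icc.2 ⟨by lia, hib⟩, hc⟩)
        lia
      have h3 : ((S.erase (col a)).card : ℝ) = S.card - 1 := by
        rw [Finset.card_erase_of_mem haS, Nat.cast_sub (Finset.card_pos.2 ⟨_, haS⟩), Nat.cast_one]
      rw [h3] at h2
      linarith [hstep j]

theorem exists_sub_le_of_monochromatic {κ : Type} {G : ℕ → ℝ} {col : ℕ → κ}
    (hcol : ∀ j k, j < k → col j = col k → G k - G j ≤ -1) (s : κ) (I : Finset ℕ)
    (hI : I.Nonempty) (hs : ∀ i ∈ I, col i = s) :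
    ∃ i ∈ I, ∃ j ∈ I, i ≤ j ∧ (∀ m ∈ I, m ≤ j) ∧ G j - G i ≤ 1 - I.card := by
  induction I using Finset.induction_on_max with
  | empty => exact absurd hI Finset.not_nonempty_empty
  | insert a I hlt ih =>
    have haI : a ∉ I := fun h => lt_irrefl _ (hlt a h)
    rcases I.eq_empty_or_nonempty with rfl | hne
    · exact ⟨a, by simp, a, by simp, le_rfl, by simp, by simp⟩
    · obtain ⟨i, hi, j, hj, hij, -, hG⟩ := ih hne fun i hi => hs i (Finset.mem_insert_of_mem hi)
      have hja := hlt j hj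
      refine ⟨i, Finset.mem_insert_of_mem hi, a, Finset.mem_insert_self _ _, hij.trans hja.le,
        fun m hm => ?_, ?_⟩
      · rcases Finset.mem_insert.1 hm with rfl | hm
        · exact le_rfl
        · exact (hlt m hm).le
      · rw [Finset.card_insert_of_notMem haI]
        push_cast
        have := hcol j a hja
          ((hs j (Finset.mem_insert_of_mem hj)).trans (hs a (Finset.mem_insert_self _ _)).symm)
        linarith

/-- Some colour occurs more than `⌊k / N⌋` times among `0, …, k`, forcing that many drops. The
stretches before and after rise by at most `N * K` each. -/
theorem sub_le_linear_of_colouring {κ : Type} [DecidableEq κ] {G : ℕ → ℝ} {col : ℕ → κ} {K : ℝ}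
    (hK : 0 ≤ K) (hstep : ∀ k, G (k + 1) - G k ≤ K)
    (hcol : ∀ j k, j < k → col j = col k → G k - G j ≤ -1) (S : Finset κ)
    (hS : ∀ i, col i ∈ S) {N : ℕ} (hN : 0 < N) (hSN : S.card ≤ N) (k : ℕ) :
    G k - G 0 ≤ 2 * (N * K) + 1 - k / N := by
  have hbd : ∀ a b, a ≤ b → G b - G a ≤ N * K := fun a b hab =>
    (sub_le_card_mul_of_colouring hK hstep hcol S a b hab fun i _ _ => hS i).trans (by gcongr)
  obtain ⟨s, -, hs⟩ := Finset.exists_lt_card_fiber_of_mul_lt_card_of_maps_to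
    (s := Finset.range (k + 1)) (t := S) (f := col) (n := k / N) (fun i _ => hS i) (by
      rw [Finset.card_range]
      have h1 := Nat.mul_le_mul_right (k / N) hSN
      have h2 := Nat.mul_div_le k N
      lia)
  obtain ⟨i, hi, j, hj, hij, -, hG⟩ := exists_sub_le_of_monochromatic hcol s
    {x ∈ Finset.range (k + 1) | col x = s} (Finset.card_pos.1 (Nat.zero_lt_of_lt hs))
    fun i hi => (Finset.mem_filter.1 hi).2
  have hjk : j ≤ k := by
    have := Finset.mem_range.1 (Finset.mem_filter.1 hj).1
    lia
  have h1 := hbd 0 i (Nat.zero_le _)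
  have h2 := hbd j k hjk
  have h3 : ((k / N : ℕ) : ℝ) + 1 ≤ ({x ∈ Finset.range (k + 1) | col x = s}.card : ℝ) := by
    exact_mod_cast hs
  have h4 : (k : ℝ) / N ≤ (k / N : ℕ) + 1 := by
    rw [div_le_iff₀ (by exact_mod_cast hN)]
    have h5 := Nat.lt_mul_div_succ k hN
    have h6 : (k : ℝ) < N * ((k / N : ℕ) + 1) := by exact_mod_cast h5
    linarith
  linarith

/-- A cocycle over a flow that is at most `-1` along every long piece of trajectory with end points
in the same one of finitely many cells decreases linearly. -/
theorem exists_linear_decay {X κ : Type} [TopologicalSpace X] (Φ : Flow ℝ X) (C : Set X)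
    (hC : ∀ x ∈ C, ∀ t, Φ t x ∈ C) (F : X → ℝ → ℝ)
    (hF : ∀ x s t, F x (s + t) = F x s + F (Φ s x) t) {K : ℝ} (hK : 0 ≤ K)
    (hbound : ∀ x t, 0 ≤ t → F x t ≤ K * (t + 1)) (cell : X → κ) (hfin : (Set.range cell).Finite)
    {T : ℝ} (hT : 0 < T) (hneg : ∀ x ∈ C, ∀ t, T ≤ t → cell x = cell (Φ t x) → F x t ≤ -1) :
    ∃ c K' : ℝ, 0 < c ∧ ∀ x ∈ C, ∀ t, 0 ≤ t → F x t ≤ K' - c * t := by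
  classical
  -- The extra `1` keeps `N` positive even without cells.
  set N := hfin.toFinset.card + 1 with hN
  have hN0 : (0 : ℝ) < N := by positivity
  -- Sample at multiples of `T`, coloured by cells. In the constant, `1 / N` pays for rounding `t /
  -- T` down and the last summand for the leftover piece.
  refine ⟨1 / (N * T), 2 * (N * (K * (T + 1))) + 1 + 1 / N + K * (T + 1), by positivity,
    fun x hx t ht => ?_⟩
  have hF0 : F x 0 = 0 := by
    have := hF x 0 0
    rw [Φ.map_zero_apply, add_zero] at this
    linarith
  have hdiff : ∀ j k : ℕ, j ≤ k →
      F x (k * T) - F x (j * T) = F (Φ (j * T) x) ((k - j : ℝ) * T) := fun j k _ => by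
    rw [show (k : ℝ) * T = j * T + (k - j) * T by ring, hF]
    ring
  have hlin := sub_le_linear_of_colouring (G := fun k : ℕ => F x (k * T))
    (col := fun k : ℕ => cell (Φ (k * T) x)) (K := K * (T + 1)) (by positivity)
    (fun k => by
      rw [hdiff k (k + 1) (Nat.le_succ k)]
      push_cast
      rw [add_sub_cancel_left, one_mul]
      exact hbound _ T hT.le)
    (fun j k hjk hc => by
      rw [hdiff j k hjk.le]
      have h1 : (1 : ℝ) ≤ k - j := by
        have : (j : ℝ) + 1 ≤ k := by exact_mod_cast hjk
        linarith
      refine hneg _ (hC x hx _) _ (by nlinarith) ?_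
      rw [← Φ.map_add]
      refine hc.trans ?_
      congr 2
      ring)
    hfin.toFinset (fun i => by simp) (N := N) (Nat.succ_pos _) (Nat.le_succ _) ⌊t / T⌋₊
  have h1 : (⌊t / T⌋₊ : ℝ) * T ≤ t := by
    rw [← le_div_iff₀ hT]
    exact Nat.floor_le (by positivity)
  have h2 : t < (⌊t / T⌋₊ + 1 : ℝ) * T := by
    rw [← div_lt_iff₀ hT]
    exact Nat.lt_floor_add_one _
  have h3 := hF x (⌊t / T⌋₊ * T) (t - ⌊t / T⌋₊ * T)
  rw [add_sub_cancel] at h3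
  have h4 := hbound (Φ (⌊t / T⌋₊ * T) x) (t - ⌊t / T⌋₊ * T) (by linarith)
  have h5 : K * (t - ⌊t / T⌋₊ * T + 1) ≤ K * (T + 1) := by
    gcongr
    linarith
  have h6 : 1 / (N * T) * t ≤ (⌊t / T⌋₊ : ℝ) / N + 1 / N := by
    rw [← add_div, div_mul_eq_mul_div, one_mul, div_le_div_iff₀ (by positivity) hN0]
    nlinarith
  simp only [Nat.cast_zero, zero_mul, hF0, sub_zero] at hlin
  linarith

end Decay

/-! ### The space of homology directions -/

section Directions

theorem exists_dual_apply_ne_zero {V : Type} [AddCommGroup V] [Module ℝ V] {v : V} (hv : v ≠ 0) :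
    ∃ f : V →ₗ[ℝ] ℝ, f v ≠ 0 := by
  by_contra! h
  exact hv ((Module.forall_dual_apply_eq_zero_iff ℝ _).1 h)

theorem exists_linearEquiv_fin (V : Type) [AddCommGroup V] [Module ℝ V] [Module.Finite ℝ V] :
    ∃ n : ℕ, Nonempty (V ≃ₗ[ℝ] (Fin n → ℝ)) :=
  ⟨_, ⟨(Module.finBasis ℝ V).equivFun⟩⟩

variable {X : Type} [TopologicalSpace X]

theorem realPairing_tmul (ξ : Cohomology₁ X) (a : ℝ) (z : Homology₁ X) :
    realPairing ξ (a ⊗ₜ[ℤ] z) = a * pairing ξ z := by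
  simp [realPairing, mul_comm]

theorem Direction.mk_eq_mk {v w : RealHomology₁ X} :
    Direction.mk v = Direction.mk w ↔ ∃ a : ℝ, 0 < a ∧ w = a • v :=
  Quotient.eq (r := directionSetoid X)

theorem Direction.mk_mem_image {S : Set (RealHomology₁ X)}
    (hS : ∀ v ∈ S, ∀ a : ℝ, 0 < a → a • v ∈ S) {w : RealHomology₁ X} :
    Direction.mk w ∈ Direction.mk '' S ↔ w ∈ S := by
  refine ⟨?_, fun h => ⟨w, h, rfl⟩⟩
  rintro ⟨v, hv, h⟩
  obtain ⟨a, ha, rfl⟩ := Direction.mk_eq_mk.1 h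
  exact hS v hv a ha

/-- The positive cone of vectors on which a linear functional is larger than a multiple of the
absolute value of another one gives an open set of directions. -/
theorem Direction.isOpen_image_of_lt (α β : RealHomology₁ X →ₗ[ℝ] ℝ) :
    IsOpen (Direction.mk '' {v : RealHomology₁ X | -|β v| < α v}) := by
  let _ : TopologicalSpace (RealHomology₁ X) := moduleTopology ℝ (RealHomology₁ X)
  have : IsModuleTopology ℝ (RealHomology₁ X) := ⟨rfl⟩
  have hα : Continuous α := IsModuleTopology.continuous_of_linearMap α
  have hβ : Continuous β := IsModuleTopology.continuous_of_linearMap β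
  refine isOpen_coinduced.2 ?_
  have hcone : ∀ v ∈ {v : RealHomology₁ X | -|β v| < α v}, ∀ a : ℝ, 0 < a →
      a • v ∈ {v : RealHomology₁ X | -|β v| < α v} := by
    intro v hv a ha
    simp only [Set.mem_ofPred_eq, map_smul, smul_eq_mul, abs_mul, abs_of_pos ha] at hv ⊢
    nlinarith
  have : (fun v : {v : RealHomology₁ X // v ≠ 0} => Direction.mk v.1) ⁻¹'
      (Direction.mk '' {v : RealHomology₁ X | -|β v| < α v}) = {v | -|β v.1| < α v.1} :=
    Set.ext fun v => Direction.mk_mem_image hcone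
  rw [this]
  exact isOpen_lt (hβ.comp continuous_subtype_val).abs.neg (hα.comp continuous_subtype_val)

/-- No nonzero vector has the direction of `0`, so the preimage that decides openness is empty. -/
theorem Direction.isOpen_singleton_mk_zero :
    IsOpen ({Direction.mk (0 : RealHomology₁ X)} : Set (Direction X)) := by
  let _ : TopologicalSpace (RealHomology₁ X) := moduleTopology ℝ (RealHomology₁ X)
  refine isOpen_coinduced.2 ?_
  convert isOpen_empty
  refine Set.eq_empty_of_forall_notMem fun v hv => v.2 ?_
  obtain ⟨a, ha, h⟩ := Direction.mk_eq_mk.1 (Set.mem_singleton_iff.1 hv)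
  rw [← one_smul ℝ v.1, ← inv_mul_cancel₀ ha.ne', mul_smul, ← h, smul_zero]

theorem Direction.pairsNegatively_mk (ξ : Cohomology₁ X) (v : RealHomology₁ X) :
    (Direction.mk v).PairsNegatively ξ ↔ realPairing ξ v < 0 := Iff.rfl

/-- A nonzero real homology class is detected by a homomorphism defined on all chains modulo
boundaries. -/
theorem exists_hom_ne_zero {v : RealHomology₁ X} (hv : v ≠ 0) :
    ∃ (g : ChainClass X →+ ℝ) (β : RealHomology₁ X →ₗ[ℝ] ℝ), β v ≠ 0 ∧
      ∀ z, β (1 ⊗ₜ[ℤ] z) = g (homologyIncl X z) := by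
  let i : RealHomology₁ X →ₗ[ℝ] ℝ ⊗[ℤ] (ChainClass X) :=
    ((singularComplex X).homologyι 1).hom.baseChange ℝ
  -- `ℝ` is flat over `ℤ`, so a functional nonzero on `v` can be found on the real span of all chain
  -- classes.
  have hi : Function.Injective i :=
    Module.Flat.lTensor_preserves_injective_linearMap _ homologyIncl_injective
  have hv' : i v ≠ 0 := fun h => hv (hi (h.trans (map_zero i).symm))
  obtain ⟨f, hf⟩ := exists_dual_apply_ne_zero hv'
  refine ⟨⟨⟨fun q => f (1 ⊗ₜ[ℤ] q), by simp⟩, fun a b => by simp [TensorProduct.tmul_add]⟩,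
    f ∘ₗ i, hf, fun z => ?_⟩
  exact congrArg f (LinearMap.baseChange_tmul _ _ _)

/-- Either `0` occurs infinitely often, or the vectors can be normalised to a compact sphere; `⟨ξ,
·⟩ ≥ 0` passes to the limit. -/
theorem Direction.exists_tendsto_subseq [Module.Finite ℤ (Homology₁ X)] (ξ : Cohomology₁ X)
    (v : ℕ → RealHomology₁ X) (hv : ∀ n, 0 ≤ realPairing ξ (v n)) :
    ∃ (φ : ℕ → ℕ) (d : Direction X), StrictMono φ ∧
      Tendsto (fun n => Direction.mk (v (φ n))) atTop (𝓝 d) ∧ ¬ d.PairsNegatively ξ := by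
  by_cases h0 : ∃ᶠ n in atTop, v n = 0
  · obtain ⟨φ, hφ, hφ0⟩ := extraction_of_frequently_atTop h0
    refine ⟨φ, Direction.mk 0, hφ, ?_, ?_⟩
    · simp only [hφ0]
      exact tendsto_const_nhds
    · rw [Direction.pairsNegatively_mk, map_zero]
      exact lt_irrefl 0
  · obtain ⟨φ, hφ, hφ0⟩ := extraction_of_eventually_atTop (not_frequently.1 h0)
    obtain ⟨m, ⟨e⟩⟩ := exists_linearEquiv_fin (RealHomology₁ X)
    have hpos : ∀ n, 0 < ‖e (v (φ n))‖ := fun n =>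
      norm_pos_iff.2 fun h => hφ0 n (e.map_eq_zero_iff.1 h)
    let w : ℕ → Metric.sphere (0 : Fin (m) → ℝ) 1 := fun n =>
      ⟨‖e (v (φ n))‖⁻¹ • e (v (φ n)), by
        rw [mem_sphere_zero_iff_norm, norm_smul, norm_inv, norm_norm,
          inv_mul_cancel₀ (hpos n).ne']⟩
    obtain ⟨u, ψ, hψ, hlim⟩ := CompactSpace.tendsto_subseq w
    have hne : ∀ u : Metric.sphere (0 : Fin (m) → ℝ) 1,
        e.symm u.1 ≠ 0 := fun u h => by
      have h1 := mem_sphere_zero_iff_norm.1 u.2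
      rw [e.symm.map_eq_zero_iff.1 h, norm_zero] at h1
      exact zero_ne_one h1
    let _ : TopologicalSpace (RealHomology₁ X) := moduleTopology ℝ (RealHomology₁ X)
    have : IsModuleTopology ℝ (RealHomology₁ X) := ⟨rfl⟩
    have : ContinuousAdd (RealHomology₁ X) := IsModuleTopology.toContinuousAdd ℝ _
    have hcont : Continuous fun u : Metric.sphere
        (0 : Fin (m) → ℝ) 1 => e.symm u.1 :=
      (IsModuleTopology.continuous_of_linearMap e.symm.toLinearMap).comp continuous_subtype_val
    have hmk : Continuous fun u : Metric.sphere
        (0 : Fin (m) → ℝ) 1 => Direction.mk (e.symm u.1) :=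
      (continuous_coinduced_rng (f := fun v : {v : RealHomology₁ X // v ≠ 0} =>
        Direction.mk v.1)).comp (hcont.subtype_mk hne)
    have hw : ∀ n, e.symm (w n).1 = ‖e (v (φ n))‖⁻¹ • v (φ n) := fun n => by
      simp [w]
    refine ⟨φ ∘ ψ, Direction.mk (e.symm u.1), hφ.comp hψ, ?_, ?_⟩
    · refine ((hmk.tendsto u).comp hlim).congr fun n => ?_
      exact (Direction.mk_eq_mk.2 ⟨_, inv_pos.2 (hpos (ψ n)), hw (ψ n)⟩).symm
    · rw [Direction.pairsNegatively_mk, not_lt]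
      have hα : Continuous (realPairing ξ) := IsModuleTopology.continuous_of_linearMap _
      refine ge_of_tendsto' (((hα.comp hcont).tendsto u).comp hlim) fun n => ?_
      change 0 ≤ realPairing ξ (e.symm (w (ψ n)).1)
      rw [hw, map_smul]
      exact mul_nonneg (inv_nonneg.2 (norm_nonneg _)) (hv _)

end Directions

/-! ### Fried's condition implies condition (B) -/

section Conditions

variable {X : Type} [MetricSpace X] [CompactSpace X] [StronglyLocallyContractibleSpace X]
  {Φ : Flow ℝ X} {ξ : Cohomology₁ X}

theorem FriedCondition.conditionB (h : FriedCondition Φ ξ) : ConditionB Φ ξ := by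
  by_contra hB
  have hex : ∀ n : ℕ, ∃ (x : X) (t : ℝ) (σ : Path (Φ t x) x) (p : X) (z : Homology₁ X),
      x ∈ circulationSet Φ ξ ∧ (n + 2 : ℝ) ≤ t ∧ dist x (Φ t x) < 1 / (n + 1 : ℝ) ∧
        Set.range σ ⊆ Metric.ball p (1 / (n + 1 : ℝ)) ∧ IsClosingClass Φ x t σ z ∧
        0 ≤ pairing ξ z := by
    intro n
    -- Failure of (B) at this fine scale gives a cycle with pairing not `≤ -1`, hence `≥ 0` by
    -- integrality.
    obtain ⟨ε, δ, hε, hδ, hscale⟩ := exists_isScale ξ (r := 1 / (n + 1 : ℝ)) (by positivity)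
    by_contra! hcon
    refine hB ⟨ε, δ, n + 2, hscale, by linarith [n.cast_nonneg (α := ℝ)],
      fun x hx t ht hd σ p hσ z hz => ?_⟩
    have := hcon x t σ p z hx ht (hd.trans_le hδ) (hσ.trans (Metric.ball_subset_ball hε)) hz
    lia
  choose x t σ p z hx ht hd hσ hz hpos using hex
  obtain ⟨q, φ, hφ, hlim⟩ := CompactSpace.tendsto_subseq x
  have := finite_homology (X := X)
  obtain ⟨ψ, d, hψ, hlimd, hneg⟩ := Direction.exists_tendsto_subseq ξ
    (fun n => 1 ⊗ₜ[ℤ] z (φ n)) (fun n => by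
      rw [realPairing_tmul, one_mul]
      exact_mod_cast hpos (φ n))
  have hφψ := (hφ.comp hψ).tendsto_atTop
  have hlim' := hlim.comp hψ.tendsto_atTop
  have hzero : Tendsto (fun n : ℕ => 1 / (n + 1 : ℝ)) atTop (𝓝 0) :=
    tendsto_one_div_add_atTop_nhds_zero_nat
  refine hneg (h q (x ∘ φ ∘ ψ) (t ∘ φ ∘ ψ) d ⟨fun n => ?_, hlim', ?_⟩ (fun n => hx _)
    ⟨fun n => σ _, fun n => z _, ?_, fun n => hz _, hlimd⟩)
  · have := ht ((φ ∘ ψ) n)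
    have h0 : (0 : ℝ) ≤ ((φ ∘ ψ) n : ℕ) := Nat.cast_nonneg _
    change 1 < t ((φ ∘ ψ) n)
    linarith
  · refine (tendsto_iff_of_dist ?_).1 hlim'
    refine squeeze_zero (fun _ => dist_nonneg) (fun n => (hd ((φ ∘ ψ) n)).le) (hzero.comp hφψ)
  · have h2 : Tendsto (fun n : ℕ => 2 * (1 / (n + 1 : ℝ))) atTop (𝓝 0) := by
      simpa using hzero.const_mul 2
    refine squeeze_zero (fun _ => Metric.diam_nonneg) (fun n => ?_) (h2.comp hφψ)
    refine (Metric.diam_mono (hσ ((φ ∘ ψ) n)) Metric.isBounded_ball).trans ?_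
    exact Metric.diam_ball (by positivity)

end Conditions

/-! ### Condition (B) implies Fried's condition -/

section Conditions

variable {X : Type} [MetricSpace X] {Φ : Flow ℝ X} {ξ : Cohomology₁ X}

theorem range_subset_ball_of_diam_lt {x y : X} (σ : Path x y) {r : ℝ}
    (h : Metric.diam (Set.range σ) < r) : Set.range σ ⊆ Metric.ball y r := fun _ ha =>
  (Metric.dist_le_diam_of_mem (isCompact_range σ.continuous).isBounded ha
    ⟨1, σ.target⟩).trans_lt h

theorem flowClass_nat_mul {p : X} {t : ℝ} (h : Φ t p = p) (k : ℕ) :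
    flowClass Φ p (k * t) = k • flowClass Φ p t := by
  induction k with
  | zero => simp [flowClass_zero]
  | succ k ih =>
    rw [Nat.cast_succ, add_one_mul, add_comm, flowClass_add, h, ih, succ_nsmul']

variable [CompactSpace X] [StronglyLocallyContractibleSpace X]

/-- The classes of a closing sequence with convergent times are eventually constant. -/
theorem IsClosingClass.eventually_homologyIncl_eq {p : X} {s : ℝ} {x : ℕ → X} {t : ℕ → ℝ}
    (hx : Tendsto x atTop (𝓝 p)) (hΦ : Tendsto (fun n => Φ (t n) (x n)) atTop (𝓝 p))
    (ht : Tendsto t atTop (𝓝 s)) {σ : ∀ n, Path (Φ (t n) (x n)) (x n)} {z : ℕ → Homology₁ X}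
    (hσ : Tendsto (fun n => Metric.diam (Set.range (σ n))) atTop (𝓝 0))
    (hz : ∀ n, IsClosingClass Φ (x n) (t n) (σ n) (z n)) :
    Φ s p = p ∧ ∀ᶠ n in atTop, homologyIncl X (z n) = flowClass Φ p s := by
  have hp : Φ s p = p := tendsto_nhds_unique
    (((Φ.continuous continuous_fst continuous_snd).tendsto (s, p)).comp (ht.prodMk_nhds hx)) hΦ
  refine ⟨hp, ?_⟩
  obtain ⟨U⟩ := exists_shortClasses (X := X)
  obtain ⟨η, hη, hunif⟩ := uniformContinuous_flow Φ (|s| + 1) U.rad_pos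
  filter_upwards [hx.eventually (Metric.ball_mem_nhds p (lt_min hη U.rad_pos)),
    hΦ.eventually (Metric.ball_mem_nhds p U.rad_pos),
    ht.eventually (Metric.ball_mem_nhds s (lt_min hη one_pos)),
    hσ.eventually (gt_mem_nhds U.rad_pos)] with n h1 h2 h3 h4
  rw [lt_min_iff] at h1 h3
  rw [Real.dist_eq] at h3
  have habs : |t n| ≤ |s| + 1 := by
    linarith [abs_sub_abs_le_abs_sub (t n) s]
  -- Parametrised proportionally over `[0, 1]`, the trajectory from `x n` is uniformly close to the
  -- closed orbit of `p`.
  have h5 := U.flowClass_add_cls (Φ := Φ) (x := x n) (y := p) (s := t n) (t := s) fun r => by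
    refine hunif _ _ _ _ ?_ ?_ ?_ h1.1
    · rw [abs_mul, abs_of_nonneg r.2.1]
      exact (mul_le_of_le_one_left (abs_nonneg _) r.2.2).trans habs
    · rw [abs_mul, abs_of_nonneg r.2.1]
      exact (mul_le_of_le_one_left (abs_nonneg _) r.2.2).trans (by linarith)
    · rw [Real.dist_eq, ← mul_sub, abs_mul, abs_of_nonneg r.2.1]
      exact (mul_le_of_le_one_left (abs_nonneg _) r.2.2).trans_lt h3.1
  rw [hp] at h5
  rw [(hz n).homologyIncl_eq, U.pathClass_eq _ _ _ _ (range_subset_ball_of_diam_lt _ h4)]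
  have h6 := U.cls_add p _ (x n) p h2 h1.2 (Metric.mem_ball_self U.rad_pos)
  rw [← h6, ← add_assoc, add_comm (U.cls (x n) p)] at h5
  exact add_right_cancel h5

/-- For long times the decay of the cocycle beats the additive constants; for bounded times the
classes eventually become, along a subsequence, that of a periodic orbit in `C_ξ`. -/
theorem ConditionB.exists_linear_decay (hR : IsIsolatedInR Φ ξ) (hB : ConditionB Φ ξ)
    {p : X} {x : ℕ → X} {t : ℕ → ℝ} (hcl : IsClosingSequence Φ p x t)
    (hC : ∀ n, x n ∈ circulationSet Φ ξ) {σ : ∀ n, Path (Φ (t n) (x n)) (x n)}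
    {z : ℕ → Homology₁ X} (hσ : Tendsto (fun n => Metric.diam (Set.range (σ n))) atTop (𝓝 0))
    (hz : ∀ n, IsClosingClass Φ (x n) (t n) (σ n) (z n)) :
    ∃ c : ℝ, 0 < c ∧ ∃ᶠ n in atTop, (pairing ξ (z n) : ℝ) ≤ -(c * t n) := by
  obtain ⟨ε, δ, T, ⟨hε, hδ, -⟩, hT, hneg⟩ := hB
  obtain ⟨f, hf, -⟩ := exists_cohomologyHom ξ
  -- Cells of this size make every sufficiently long return to a cell a `(δ, T)`-cycle closed up
  -- inside an `ε`-ball, so (B) applies.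
  obtain ⟨D⟩ := exists_cells (X := X) (lt_min hε (half_pos hδ))
  let g : ChainClass X →+ ℝ := (Int.castAddHom ℝ).comp f
  obtain ⟨K, hK, hshort, hgrow⟩ := D.exists_growth_bound Φ g
  have hcell : ∀ y ∈ circulationSet Φ ξ, ∀ s, T ≤ s → D.cell y = D.cell (Φ s y) →
      g (D.proj (flowClass Φ y s)) ≤ -1 := by
    intro y hy s hs hc
    obtain ⟨τ, q, hτ, hτ0⟩ := D.exists_path (Φ s y) y hc.symm
    obtain ⟨w, hw⟩ := exists_isClosingClass y s τ
    have h1 : dist y q < δ / 2 := (hτ ⟨1, τ.target⟩ : _ < _).trans_le (min_le_right _ _)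
    have h2 : dist (Φ s y) q < δ / 2 := (hτ ⟨0, τ.source⟩ : _ < _).trans_le (min_le_right _ _)
    have h3 := hneg y hy s hs (by linarith [dist_triangle_right y (Φ s y) q]) τ q
      (hτ.trans (Metric.ball_subset_ball (min_le_left _ _))) w hw
    rw [hf, ← D.proj_homologyIncl, hw.homologyIncl_eq, map_add, hτ0, add_zero] at h3
    change ((f (D.proj (flowClass Φ y s)) : ℤ) : ℝ) ≤ -1
    exact_mod_cast h3
  obtain ⟨c, K', hc, hdecay⟩ := FlowClosing.exists_linear_decay Φ (circulationSet Φ ξ)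
    (fun y hy s => map_mem_circulationSet hy s) (fun y s => g (D.proj (flowClass Φ y s)))
    (fun y s r => by rw [flowClass_add, map_add, map_add]) hK.le
    (fun y s hs => (le_abs_self _).trans (hgrow y s hs)) D.cell D.finite_range
    (by linarith) hcell
  have hpair : ∀ᶠ n in atTop, (pairing ξ (z n) : ℝ) ≤ K' + K - c * t n := by
    filter_upwards [hσ.eventually (gt_mem_nhds D.rad_pos)] with n hn
    have h1 := hdecay (x n) (hC n) (t n) (by linarith [hcl.1 n])
    have h2 := (le_abs_self _).trans
      (hshort _ _ _ (σ n) (range_subset_ball_of_diam_lt _ hn))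
    have h3 : (pairing ξ (z n) : ℝ) = g (D.proj (flowClass Φ (x n) (t n))) +
        g (D.proj (pathClass (σ n))) := by
      rw [← map_add, ← map_add, ← (hz n).homologyIncl_eq, D.proj_homologyIncl, hf]
      rfl
    linarith
  -- Beyond `T'`, half of the decay `c * t` absorbs `K' + K`.
  set T' := max 1 (2 * (K' + K) / c) with hT'
  by_cases hfreq : ∃ᶠ n in atTop, T' < t n
  · refine ⟨c / 2, half_pos hc, (hfreq.and_eventually hpair).mono fun n hn => ?_⟩
    have h1 := (le_max_right _ _).trans_lt hn.1
    rw [div_lt_iff₀ hc] at h1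
    linarith [hn.2]
  · have hev := not_frequently.1 hfreq
    obtain ⟨s, hs, φ, hφ, hlim⟩ := (isCompact_Icc (a := (1 : ℝ)) (b := T')).tendsto_subseq'
      (x := t) (hev.mono fun n hn => ⟨(hcl.1 n).le, not_lt.1 hn⟩).frequently
    have hφ' := hφ.tendsto_atTop
    obtain ⟨hp, hconst⟩ := IsClosingClass.eventually_homologyIncl_eq (hcl.2.1.comp hφ')
      (hcl.2.2.comp hφ') hlim (hσ.comp hφ') fun n => hz (φ n)
    have hpC : p ∈ circulationSet Φ ξ :=
      hR.isClosed_circulationSet.mem_of_tendsto hcl.2.1 (Eventually.of_forall hC)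
    -- The period `s` may be shorter than `T`, so (B) is applied to the orbit traversed `k` times;
    -- only the sign survives division by `k`, and integrality restores `≤ -1`.
    obtain ⟨k, hk⟩ := exists_nat_ge T
    have hks : T ≤ k * s := hk.trans (le_mul_of_one_le_right k.cast_nonneg hs.1)
    have hkp : Φ (k * s) p = p := by
      clear hks hk
      induction k with
      | zero => simp
      | succ k ih => rw [Nat.cast_succ, add_one_mul, Φ.map_add, hp, ih]
    have h1 := hcell p hpC (k * s) hks (by rw [hkp])
    rw [flowClass_nat_mul hp, map_nsmul, map_nsmul, nsmul_eq_mul] at h1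
    have hT0 : 0 < T' := one_pos.trans_le (le_max_left _ _)
    refine ⟨1 / T', by positivity, hφ'.frequently (Eventually.frequently ?_)⟩
    filter_upwards [hconst, hφ'.eventually hev] with n hn hn'
    have h2 : (pairing ξ (z (φ n)) : ℝ) = g (D.proj (flowClass Φ p s)) := by
      rw [← hn, D.proj_homologyIncl, hf]
      rfl
    rw [← h2] at h1
    have h3 : pairing ξ (z (φ n)) < 0 := by
      by_contra! h
      have h4 : (0 : ℝ) ≤ pairing ξ (z (φ n)) := by exact_mod_cast h
      have := mul_nonneg k.cast_nonneg h4
      linarith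
    have h4 : (pairing ξ (z (φ n)) : ℝ) ≤ -1 := by exact_mod_cast Int.le_sub_one_of_lt h3
    have h5 : 1 / T' * t (φ n) ≤ 1 := by
      rw [one_div_mul_eq_div, div_le_one hT0]
      exact not_lt.1 hn'
    linarith

theorem ConditionB.friedCondition (hR : IsIsolatedInR Φ ξ) (hB : ConditionB Φ ξ) :
    FriedCondition Φ ξ := by
  rintro p x t d hcl hC ⟨σ, z, hσ, hz, hlim⟩
  obtain ⟨c, hc, hfreq⟩ := hB.exists_linear_decay hR hcl hC hσ hz
  obtain ⟨v, rfl⟩ := Quotient.exists_rep d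
  change (Direction.mk v).PairsNegatively ξ
  change Tendsto _ _ (𝓝 (Direction.mk v)) at hlim
  rw [Direction.pairsNegatively_mk]
  by_contra! hv
  rcases eq_or_ne v 0 with rfl | hv0
  · have h0 := hlim.eventually (Direction.isOpen_singleton_mk_zero.mem_nhds rfl)
    obtain ⟨n, hn, hn0⟩ := (hfreq.and_eventually h0).exists
    obtain ⟨a, -, ha⟩ := Direction.mk_eq_mk.1 (Set.mem_singleton_iff.1 hn0).symm
    have h1 := realPairing_tmul ξ 1 (z n)
    rw [ha, smul_zero, map_zero, one_mul] at h1
    nlinarith [hcl.1 n]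
  · obtain ⟨g, β, hβ, hgβ⟩ := exists_hom_ne_zero hv0
    obtain ⟨D⟩ := exists_cells (X := X) one_pos
    obtain ⟨K, hK, hshort, hgrow⟩ := D.exists_growth_bound Φ g
    -- As `t n > 1`, `|β|` is at most `K * (t n + 1) + K ≤ 3 * K * t n` on late classes, so `|β'| ≤
    -- c * t n`. The cone `-|β'| < ξ` contains `v`, even if `⟨ξ, v⟩ = 0`, but not the classes on
    -- which `ξ ≤ -(c * t n)`.
    let β' : RealHomology₁ X →ₗ[ℝ] ℝ := (c / (3 * K)) • β
    have hβ' : ∀ w, |β' w| = c / (3 * K) * |β w| := fun w => by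
      rw [LinearMap.smul_apply, smul_eq_mul, abs_mul, abs_of_pos (by positivity)]
    have hopen := Direction.isOpen_image_of_lt (realPairing ξ) β'
    have hcone : ∀ w ∈ {w : RealHomology₁ X | -|β' w| < realPairing ξ w}, ∀ a : ℝ, 0 < a →
        a • w ∈ {w : RealHomology₁ X | -|β' w| < realPairing ξ w} := by
      intro w hw a ha
      simp only [Set.mem_ofPred_eq, map_smul, smul_eq_mul, abs_mul, abs_of_pos ha] at hw ⊢
      nlinarith
    have hmem : v ∈ {w : RealHomology₁ X | -|β' w| < realPairing ξ w} := by
      have : 0 < |β' v| := by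
        rw [hβ']
        have := abs_pos.2 hβ
        positivity
      exact lt_of_lt_of_le (neg_neg_of_pos this) hv
    have h0 := hlim.eventually (hopen.mem_nhds ⟨v, hmem, rfl⟩)
    obtain ⟨n, ⟨hn, hn0⟩, hn1⟩ := ((hfreq.and_eventually h0).and_eventually
      (hσ.eventually (gt_mem_nhds D.rad_pos))).exists
    have h1 := (Direction.mk_mem_image hcone).1 hn0
    rw [Set.mem_ofPred_eq, realPairing_tmul, one_mul, hβ', hgβ, ← D.proj_homologyIncl,
      (hz n).homologyIncl_eq, map_add, map_add] at h1
    have h2 := hgrow (x n) (t n) (by linarith [hcl.1 n])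
    have h3 := hshort _ _ _ (σ n) (range_subset_ball_of_diam_lt _ hn1)
    have h4 : |g (D.proj (flowClass Φ (x n) (t n))) + g (D.proj (pathClass (σ n)))| ≤
        3 * K * t n := by
      refine (abs_add_le _ _).trans ?_
      nlinarith [hcl.1 n]
    have h5 : c / (3 * K) *
        |g (D.proj (flowClass Φ (x n) (t n))) + g (D.proj (pathClass (σ n)))| ≤ c * t n := by
      refine (mul_le_mul_of_nonneg_left h4 (by positivity)).trans_eq ?_
      field_simp
    linarith

end Conditions

end FlowClosing

end

theorem proposition1p6 {X : Type} [MetricSpace X] (hX : FlowClosing.IsFinitePolyhedron X)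
    (ξ : FlowClosing.Cohomology₁ X) (Φ : Flow ℝ X) (hR : FlowClosing.IsIsolatedInR Φ ξ) :
    FlowClosing.ConditionB Φ ξ ↔ FlowClosing.FriedCondition Φ ξ := by
  have := hX.compactSpace
  have := hX.stronglyLocallyContractibleSpace
  exact ⟨fun h => h.friedCondition hR, fun h => h.conditionB⟩
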